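/- Notation. For $q\in(1,2]$ and $(d_i)_{i\ge1}\in\{0,1\}^{\mathbb N}$ put $(d_1d_2\dots)_q=\sum_{i\ge1}d_iq^{-i}$; $(d_i)$ is a $q$-expansion of $x$ if $(d_1d_2\dots)_q=x$. For $x>0$ let $\mathscr U(x)$ be the set of all $q\in(1,2]$ such that $x$ has exactly one $q$-expansion, let $q_s(x)=\inf\mathscr U(x)$, and for $q>1$ let $L(q)=\{x>0: q_s(x)=q\}$ be the level sets of $q_s$. For $q\in(1,2]$ let $\alpha(q)=\alpha_1(q)\alpha_2(q)\dots$ be the quasi-greedy $q$-expansion of $1$, that is, the lexicographically largest $q$-expansion of $1$ that does not end with $0^\infty$; put $\alpha(1)=0^\infty$. For a word $\mathbf c$ over $\{0,1\}$ let $\overline{\mathbf c}$ be the word obtained by replacing each digit $c$ by $1-c$, and, if $\mathbf c$ ends in $0$, let $\mathbf c^+$ be the word obtained by replacing its last digit by $1$. A word $a_1\dots a_m$ ($m\ge1$) over $\{0,1\}$ is admissible if $\overline{a_1\dots a_{m-i}}\preccurlyeq a_{i+1}\dots a_m\prec a_1\dots a_{m-i}$ lexicographically for all $1\le i<m$. For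 such a word $\mathbf a$ (ending in $0$) define $(\theta_i(\mathbf a))_{i\ge1}$ by $\theta_1\dots\theta_m=\mathbf a^+$ and $\theta_{2^nm+1}\dots\theta_{2^{n+1}m}=\overline{\theta_1\dots\theta_{2^nm}}^{\,+}$ for all $n\ge0$. A number $\hat q_c$ is the de Vries–Komornik number generated by an admissible word $\mathbf a$, written $\hat q_c=\hat q_c(\mathbf a)$, if some interval $(\hat q_0,\hat q_c)$ is a connected component of $(1,2]\setminus\overline{\mathscr U(1)}$ (with $\overline{\mathscr U(1)}$ the closure of $\mathscr U(1)$) such that $\alpha(\hat q_0)=\mathbf a^\infty$ and $\alpha(\hat q_c)=(\theta_i(\mathbf a))$. Let $q_{KL}\approx1.787$ be the Komornik–Loreti constant, the unique root in $(1,2)$ of $\sum_{i\ge1}\tau_iq^{-i}=1$, where $\tau_i\in\{0,1\}$ is the parity of the number of ones in the binary representation of $i$, and let $Q_3\approx1.839$ be the unique positive root of $q^{-1}+q^{-2}+q^{-3}=1$. Theorem. (a) Let $\hat q_c(\mathbf a)\in(q_{KL},Q_3)$ be a de Vries–Komornik number generated by an admissible word $\mathbf a$ of length $m$, let $(\alpha_i)=\alpha(\hat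 q_c(\mathbf a))$, and for $n\in\mathbb N$ put $x_n=(\alpha_n\alpha_{n+1}\dots)_{\hat q_c(\mathbf a)}$. Then, for every $n$ of the form $n=m2^{k-1}$ or $n=m(2^{2k-1}-1)$ with $k\in\mathbb N=\{1,2,\dots\}$, the minimum of $\mathscr U(x_n)$ exists and $\min\mathscr U(x_n)=\hat q_c(\mathbf a)$. (b) The function $q_s$ has infinitely many infinite level sets, that is, $L(q)$ is infinite for infinitely many $q>1$. -/

import Mathlib

open Set

/-- Infinite sequences of zeros and ones. The entry with index `i` is the digit number `i + 1`. -/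
abbrev BinSeq : Type := ℕ → Fin 2

/-- The value `d₁/q + d₂/q² + ⋯` of a sequence in base `q` (the series converges for `q > 1`). -/
noncomputable def seqValue (q : ℝ) (d : BinSeq) : ℝ :=
  ∑' i : ℕ, ((d i : ℕ) : ℝ) / q ^ (i + 1)

/-- `d` is a `q`-expansion of `x`. -/
def IsExpansion (q x : ℝ) (d : BinSeq) : Prop :=
  HasSum (fun i : ℕ => ((d i : ℕ) : ℝ) / q ^ (i + 1)) x

/-- The set of all bases `q ∈ (1,2]` in which `x` has a unique expansion. -/
def univoqueBases (x : ℝ) : Set ℝ :=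
  {q : ℝ | 1 < q ∧ q ≤ 2 ∧ ∃! d : BinSeq, IsExpansion q x d}

/-- The smallest univoque base `q_s(x)`, the infimum of the univoque bases of `x`. -/
noncomputable def smallestBase (x : ℝ) : ℝ := sInf (univoqueBases x)

/-- The level set of `q_s` at the level `q`, as a subset of the positive reals. -/
def levelSet (q : ℝ) : Set ℝ := {x : ℝ | 0 < x ∧ smallestBase x = q}

/-- The sequence does not end with `000…`. -/
def NotEndingInZeros (d : BinSeq) : Prop := ∀ N : ℕ, ∃ i : ℕ, N ≤ i ∧ d i = 1

/-- `d` is the quasi-greedy `q`-expansion of `x`: the lexicographically largest one among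
the `q`-expansions of `x` not ending with `000…`. -/
def IsQuasiGreedy (q x : ℝ) (d : BinSeq) : Prop :=
  (IsExpansion q x d ∧ NotEndingInZeros d) ∧
    ∀ e : BinSeq, IsExpansion q x e → NotEndingInZeros e → toLex e ≤ toLex d

/-- `d = α(q)`: the quasi-greedy expansion of `1` in base `q ∈ (1,2]`,
with the convention `α(1) = 000…`. -/
def IsAlpha (q : ℝ) (d : BinSeq) : Prop :=
  (q = 1 ∧ d = fun _ => 0) ∨ (1 < q ∧ q ≤ 2 ∧ IsQuasiGreedy q 1 d)

/-- Reflection of a word. -/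
def reflectWord (w : List (Fin 2)) : List (Fin 2) := w.map (fun c => 1 - c)

/-- The word `w⁺`: the last digit is replaced by `1`
(applied to non-empty words whose last digit is `0`). -/
def plusWord (w : List (Fin 2)) : List (Fin 2) := w.dropLast ++ [1]

/-- Admissible words: `a₁…a_m` with `m ≥ 1` such that, for all `1 ≤ i < m`, the word
`a_{i+1}…a_m` is at least the reflection of `a₁…a_{m-i}` and smaller than `a₁…a_{m-i}`,
in the lexicographic order. -/
def IsAdmissible (a : List (Fin 2)) : Prop :=
  a ≠ [] ∧ ∀ i : ℕ, 1 ≤ i → i < a.length →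
    reflectWord (a.take (a.length - i)) ≤ a.drop i ∧ a.drop i < a.take (a.length - i)

/-- The periodic sequence `aaa…`. -/
def periodicSeq (a : List (Fin 2)) : BinSeq := fun i => a.getD (i % a.length) 0

/-- The prefix of length `2ⁿ m` of the sequence `θ(a)`, where `m` is the length of `a`. -/
def thetaWord (a : List (Fin 2)) : ℕ → List (Fin 2)
  | 0 => plusWord a
  | n + 1 => thetaWord a n ++ plusWord (reflectWord (thetaWord a n))

/-- The sequence `θ(a)` with `θ₁…θ_m = a⁺` and with
`θ_{2ⁿm+1}…θ_{2ⁿ⁺¹m} = (reflection of θ₁…θ_{2ⁿm})⁺` for all `n ≥ 0`. -/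
def thetaSeq (a : List (Fin 2)) : BinSeq := fun i => (thetaWord a i).getD i 0

/-- The set `(1,2]` without the closure of the set of univoque bases of `1`. -/
def nonUnivoque : Set ℝ := Ioc 1 2 \ closure (univoqueBases 1)

/-- `(p, q)` is a connected component of `(1,2]` without the closure of the set of
univoque bases of `1`. -/
def IsBasicInterval (p q : ℝ) : Prop :=
  ∃ t ∈ nonUnivoque, connectedComponentIn nonUnivoque t = Ioo p q

/-- `q` is the de Vries-Komornik number generated by the admissible word `a`: it is the right
endpoint of a basic interval `(p, q)` with `α(p) = aaa…` and `α(q) = θ(a)`. -/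
def IsDeVriesKomornik (a : List (Fin 2)) (q : ℝ) : Prop :=
  IsAdmissible a ∧
    ∃ p : ℝ, IsBasicInterval p q ∧ IsAlpha p (periodicSeq a) ∧ IsAlpha q (thetaSeq a)

/-- The Thue-Morse sequence: the parity of the number of ones in the binary representation. -/
def thueMorse (i : ℕ) : ℕ := (Nat.digits 2 i).sum % 2

/-- `q` is the Komornik-Loreti constant, the unique root in `(1,2)` of
`1 = τ₁/q + τ₂/q² + ⋯`, where `τ` is the Thue-Morse sequence. -/
def IsKomornikLoreti (q : ℝ) : Prop :=
  q ∈ Ioo (1 : ℝ) 2 ∧ HasSum (fun i : ℕ => (thueMorse (i + 1) : ℝ) / q ^ (i + 1)) 1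

/-- `q` is the tribonacci number, the unique positive root of `1/q + 1/q² + 1/q³ = 1`. -/
def IsTribonacci (q : ℝ) : Prop :=
  0 < q ∧ 1 / q + 1 / q ^ 2 + 1 / q ^ 3 = 1

/-! Let θ = θ(a), let q be the base in which θ has value 1, and let d be the tail of θ that starts
at θ_n. Admissibility of a puts every tail of θ strictly above the reflection of θ and every proper
tail strictly below θ. Hence all tails of θ are unique expansions in base q
(`IsDoubling.isUnivoque`), and q is a univoque base of x_n.

Suppose that some p < q is one too, with unique expansion c. The quasi-greedy expansion β of 1 in
base p first drops below θ at some index s, and c satisfies the lexicographic conditions with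
respect to β. Since the base is smaller, c drops below d, at a digit j; q < Q₃ forces c to begin
with 1. Comparing the loss of value of d with that of θ shows that c follows θ at least up to index
s (`IsDoubling.exists_early_branch`).

This is impossible after a position 2^r m, where θ continues with reflected prefixes of itself.
Dropping below such a prefix violates a condition (`not_below_reflection`). So does containing one
of length l with s < 2l: if w is the prefix, then β is at most γ = (w w̄)^∞, and a sequence starting
with w̄ cannot have both its reflection and its tail after w̄ below γ
(`not_starts_with_reflection`). Together these give `IsDoubling.no_branch`.

For n = m(2^{2k-1}-1) with k ≥ 2, d is a 1 followed by the block of length m that precedes index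
2^{2k-1}m. The same tools leave one case, j = m with s ≥ 2m, which `base_change_estimate` excludes
numerically; there q_KL < q < Q₃ enters through m ≥ 4 and θ = 110….

For (b), minimality at the positions 2^r m needs only q < Q₃ and makes L(q) infinite; the words
1(10)^k with k ≥ 2 supply infinitely many such q. -/

/-! ### Digit sequences and their values -/

/-- The tail of a sequence after the first `k` digits. -/
def shift (d : BinSeq) (k : ℕ) : BinSeq := fun i => d (k + i)

/-- The reflection of a sequence. -/
def reflectSeq (d : BinSeq) : BinSeq := fun i => 1 - d i

theorem fin_two_cases (x : Fin 2) : x = 0 ∨ x = 1 := by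
  revert x; decide

theorem one_sub_one_sub_fin_two (x : Fin 2) : 1 - (1 - x) = x := by
  revert x; decide

theorem shift_shift (d : BinSeq) (k l : ℕ) : shift (shift d k) l = shift d (k + l) := by
  funext i; simp [shift, add_assoc]

theorem shift_zero (d : BinSeq) : shift d 0 = d := by
  funext i; simp [shift]

theorem reflectSeq_reflectSeq (d : BinSeq) : reflectSeq (reflectSeq d) = d := by
  funext i; simp [reflectSeq]

theorem reflectSeq_shift (d : BinSeq) (k : ℕ) : reflectSeq (shift d k) = shift (reflectSeq d) k :=
  rfl

theorem digit_nonneg (x : Fin 2) : (0 : ℝ) ≤ ((x : ℕ) : ℝ) := by positivity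

theorem digit_le_one (x : Fin 2) : ((x : ℕ) : ℝ) ≤ 1 := by
  rcases fin_two_cases x with rfl | rfl <;> simp

theorem digit_reflect (x : Fin 2) : (((1 - x : Fin 2) : ℕ) : ℝ) = 1 - ((x : ℕ) : ℝ) := by
  rcases fin_two_cases x with rfl | rfl <;> simp

theorem hasSum_ones {q : ℝ} (hq : 1 < q) :
    HasSum (fun i : ℕ => 1 / q ^ (i + 1)) (1 / (q - 1)) := by
  have h0 : 0 < q := by linarith
  have h := (hasSum_geometric_of_lt_one (r := 1 / q) (by positivity)
    (by rw [div_lt_one h0]; exact hq)).mul_left (1 / q)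
  have h1 : q - 1 ≠ 0 := by linarith
  have h2 : 1 / q * (1 - 1 / q)⁻¹ = 1 / (q - 1) := by field_simp
  have h3 : (fun i : ℕ => 1 / q * (1 / q) ^ i) = fun i => 1 / q ^ (i + 1) := by
    funext i
    rw [← pow_succ', one_div_pow]
  rwa [h2, h3] at h

theorem seqValue_summable {q : ℝ} (hq : 1 < q) (d : BinSeq) :
    Summable (fun i : ℕ => ((d i : ℕ) : ℝ) / q ^ (i + 1)) := by
  have h0 : 0 < q := by linarith
  refine Summable.of_nonneg_of_le (fun i => ?_) (fun i => ?_) (hasSum_ones hq).summable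
  · have := digit_nonneg (d i); positivity
  · have := digit_le_one (d i); gcongr

theorem seqValue_hasSum {q : ℝ} (hq : 1 < q) (d : BinSeq) :
    HasSum (fun i : ℕ => ((d i : ℕ) : ℝ) / q ^ (i + 1)) (seqValue q d) :=
  (seqValue_summable hq d).hasSum

theorem isExpansion_iff {q x : ℝ} (hq : 1 < q) (d : BinSeq) :
    IsExpansion q x d ↔ seqValue q d = x :=
  ⟨fun h => h.tsum_eq, fun h => h ▸ seqValue_hasSum hq d⟩

/-- The value of the first `n` digits. -/
noncomputable def prefixValue (q : ℝ) (d : BinSeq) (n : ℕ) : ℝ :=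
  ∑ i ∈ Finset.range n, ((d i : ℕ) : ℝ) / q ^ (i + 1)

theorem seqValue_split {q : ℝ} (hq : 1 < q) (d : BinSeq) (n : ℕ) :
    seqValue q d = prefixValue q d n + seqValue q (shift d n) / q ^ n := by
  have h0 : 0 < q := by linarith
  have h := (seqValue_summable hq d).sum_add_tsum_nat_add n
  unfold prefixValue
  rw [show seqValue q d = ∑' i : ℕ, ((d i : ℕ) : ℝ) / q ^ (i + 1) from rfl, ← h]
  congr 1
  rw [seqValue, ← tsum_div_const]
  congr 1
  funext i
  rw [div_div]
  simp only [shift]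
  rw [add_comm n i, ← pow_add]
  congr 2
  ring

theorem seqValue_succ {q : ℝ} (hq : 1 < q) (d : BinSeq) :
    seqValue q d = (((d 0 : ℕ) : ℝ) + seqValue q (shift d 1)) / q := by
  rw [seqValue_split hq d 1]
  simp [prefixValue, add_div]

theorem seqValue_nonneg {q : ℝ} (hq : 1 < q) (d : BinSeq) : 0 ≤ seqValue q d := by
  have h0 : 0 < q := by linarith
  refine tsum_nonneg fun i => ?_
  have := digit_nonneg (d i); positivity

theorem seqValue_reflectSeq {q : ℝ} (hq : 1 < q) (d : BinSeq) :
    seqValue q (reflectSeq d) = 1 / (q - 1) - seqValue q d := by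
  have h := (hasSum_ones hq).sub (seqValue_hasSum hq d)
  rw [← h.tsum_eq]
  unfold seqValue reflectSeq
  congr 1
  funext i
  rw [digit_reflect, sub_div]

theorem seqValue_le {q : ℝ} (hq : 1 < q) (d : BinSeq) : seqValue q d ≤ 1 / (q - 1) := by
  have := seqValue_nonneg hq (reflectSeq d)
  rw [seqValue_reflectSeq hq] at this
  linarith

theorem prefixValue_nonneg {q : ℝ} (hq : 1 < q) (d : BinSeq) (n : ℕ) : 0 ≤ prefixValue q d n := by
  have h0 : 0 < q := by linarith
  refine Finset.sum_nonneg fun i _ => ?_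
  have := digit_nonneg (d i); positivity

theorem prefixValue_congr {q : ℝ} {d e : BinSeq} {n : ℕ} (h : ∀ i < n, d i = e i) :
    prefixValue q d n = prefixValue q e n :=
  Finset.sum_congr rfl fun i hi => by rw [h i (Finset.mem_range.1 hi)]

theorem prefixValue_le {q : ℝ} (hq : 1 < q) (d : BinSeq) (n : ℕ) :
    prefixValue q d n ≤ seqValue q d := by
  have h0 : 0 < q := by linarith
  rw [seqValue_split hq d n]
  have := seqValue_nonneg hq (shift d n)
  have : 0 ≤ seqValue q (shift d n) / q ^ n := by positivity
  linarith

theorem prefixValue_anti {p q : ℝ} (hp : 1 < p) (hpq : p ≤ q) (d : BinSeq) (n : ℕ) :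
    prefixValue q d n ≤ prefixValue p d n := by
  have h0 : 0 < p := by linarith
  refine Finset.sum_le_sum fun i _ => ?_
  have := digit_nonneg (d i)
  gcongr

theorem seqValue_anti {p q : ℝ} (hp : 1 < p) (hpq : p ≤ q) (d : BinSeq) :
    seqValue q d ≤ seqValue p d := by
  have h0 : 0 < p := by linarith
  refine (seqValue_summable (by linarith) d).tsum_le_tsum (fun i => ?_) (seqValue_summable hp d)
  have := digit_nonneg (d i)
  gcongr

theorem inv_pow_le_seqValue {q : ℝ} (hq : 1 < q) {d : BinSeq} {k : ℕ} (h : d k = 1) :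
    1 / q ^ (k + 1) ≤ seqValue q d := by
  have h0 : 0 < q := by linarith
  have := prefixValue_le hq d (k + 1)
  have h2 := prefixValue_nonneg hq d k
  unfold prefixValue at *
  rw [Finset.sum_range_succ, h] at this
  simp at this h2 ⊢
  linarith

theorem seqValue_pos {q : ℝ} (hq : 1 < q) {d : BinSeq} {k : ℕ} (h : d k = 1) :
    0 < seqValue q d := by
  have h0 : 0 < q := by linarith
  exact lt_of_lt_of_le (by positivity) (inv_pow_le_seqValue hq h)

theorem seqValue_strictAnti {p q : ℝ} (hp : 1 < p) (hpq : p < q) {d : BinSeq} {k : ℕ}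
    (h : d k = 1) : seqValue q d < seqValue p d := by
  have h0 : 0 < p := by linarith
  have h1 : 0 < q := by linarith
  rw [seqValue_split hp d k, seqValue_split (hp.trans hpq) d k]
  have h2 := prefixValue_anti hp hpq.le d k
  have h4 : (shift d k) 0 = 1 := by simpa [shift] using h
  have h5 : seqValue q (shift d k) < seqValue p (shift d k) := by
    rw [seqValue_succ hp, seqValue_succ (hp.trans hpq), h4]
    have := seqValue_anti hp hpq.le (shift (shift d k) 1)
    have h6 := seqValue_nonneg (hp.trans hpq) (shift (shift d k) 1)
    calc _ ≤ (((1 : Fin 2) : ℕ) + seqValue p (shift (shift d k) 1)) / q := by gcongr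
      _ < _ := by
        have : 0 ≤ seqValue p (shift (shift d k) 1) := h6.trans this
        have : (0 : ℝ) < (((1 : Fin 2) : ℕ) + seqValue p (shift (shift d k) 1)) := by
          simp; linarith
        gcongr
  have h6 : seqValue q (shift d k) / q ^ k ≤ seqValue q (shift d k) / p ^ k := by
    have := seqValue_nonneg (hp.trans hpq) (shift d k)
    gcongr
  have h7 : seqValue q (shift d k) / p ^ k < seqValue p (shift d k) / p ^ k := by gcongr
  linarith

/-- Comparison of two values at the first digit where the sequences differ. -/
theorem seqValue_sub_of_first_diff {q : ℝ} (hq : 1 < q) {x y : BinSeq} {k : ℕ}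
    (hxy : ∀ i < k, x i = y i) (hx : x k = 0) (hy : y k = 1) :
    seqValue q y - seqValue q x =
      (1 + seqValue q (shift y (k + 1)) - seqValue q (shift x (k + 1))) / q ^ (k + 1) := by
  have h0 : 0 < q := by linarith
  rw [seqValue_split hq y k, seqValue_split hq x k, prefixValue_congr hxy,
    seqValue_succ hq (shift y k), seqValue_succ hq (shift x k), shift_shift, shift_shift]
  simp only [shift, add_zero, hx, hy]
  simp
  field_simp
  ring

/-! ### Lexicographic order -/

/-- Strict lexicographic order. -/
def LexLT (x y : BinSeq) : Prop := ∃ k, (∀ i < k, x i = y i) ∧ x k = 0 ∧ y k = 1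

theorem lexLT_trichotomy (x y : BinSeq) : x = y ∨ LexLT x y ∨ LexLT y x := by
  by_cases h : x = y
  · exact Or.inl h
  · right
    have h' : ∃ i, x i ≠ y i := by
      by_contra hc; push Not at hc; exact h (funext hc)
    classical
    have h1 := Nat.find_spec h'
    have h2 : ∀ i < Nat.find h', x i = y i := fun i hi => by
      simpa using Nat.find_min h' hi
    rcases fin_two_cases (x (Nat.find h')) with hx | hx <;>
      rcases fin_two_cases (y (Nat.find h')) with hy | hy
    · exact absurd (hx.trans hy.symm) h1
    · exact Or.inl ⟨_, h2, hx, hy⟩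
    · exact Or.inr ⟨_, fun i hi => (h2 i hi).symm, hy, hx⟩
    · exact absurd (hx.trans hy.symm) h1

theorem LexLT.irrefl (x : BinSeq) : ¬ LexLT x x := by
  rintro ⟨k, -, h0, h1⟩
  rw [h0] at h1; exact absurd h1 (by decide)

theorem LexLT.trans {x y z : BinSeq} (hxy : LexLT x y) (hyz : LexLT y z) : LexLT x z := by
  obtain ⟨k, hk, hk0, hk1⟩ := hxy
  obtain ⟨l, hl, hl0, hl1⟩ := hyz
  rcases lt_trichotomy k l with h | h | h
  · exact ⟨k, fun i hi => (hk i hi).trans (hl i (hi.trans h)), hk0, hl k h ▸ hk1⟩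
  · subst h; rw [hl0] at hk1; exact absurd hk1 (by decide)
  · exact ⟨l, fun i hi => (hk i (hi.trans h)).trans (hl i hi), (hk l h).trans hl0, hl1⟩

theorem LexLT.asymm {x y : BinSeq} (hxy : LexLT x y) : ¬ LexLT y x :=
  fun h => LexLT.irrefl x (hxy.trans h)

theorem LexLT.reflect {x y : BinSeq} (hxy : LexLT x y) : LexLT (reflectSeq y) (reflectSeq x) := by
  obtain ⟨k, hk, hk0, hk1⟩ := hxy
  exact ⟨k, fun i hi => by simp [reflectSeq, hk i hi], by simp [reflectSeq, hk1],
    by simp [reflectSeq, hk0]⟩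

/-! ### Existence of expansions -/

/-- If the remainders `r` of a digit sequence stay bounded, then they are the tail values. -/
theorem seqValue_of_remainders {p B : ℝ} (hp : 1 < p) {d : BinSeq} {r : ℕ → ℝ}
    (hr : ∀ i, r (i + 1) = p * r i - ((d i : ℕ) : ℝ)) (hB : ∀ i, |r i| ≤ B) (n : ℕ) :
    seqValue p (shift d n) = r n := by
  have h0 : 0 < p := by linarith
  -- The error is multiplied by p at each step, so a nonzero error would be unbounded.
  have key : ∀ i, seqValue p (shift d (n + i)) - r (n + i)
      = p ^ i * (seqValue p (shift d n) - r n) := by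
    intro i
    induction i with
    | zero => simp
    | succ i ih =>
      have h1 := seqValue_succ hp (shift d (n + i))
      rw [shift_shift] at h1
      have h2 : (shift d (n + i)) 0 = d (n + i) := by simp [shift]
      rw [h2, eq_div_iff h0.ne'] at h1
      rw [pow_succ, show n + (i + 1) = n + i + 1 from rfl, hr]
      linear_combination p * ih - h1
  by_contra hne
  have hpos : 0 < |seqValue p (shift d n) - r n| := abs_pos.2 (sub_ne_zero.2 hne)
  obtain ⟨i, hi⟩ := pow_unbounded_of_one_lt ((1 / (p - 1) + B) / |seqValue p (shift d n) - r n|) hp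
  rw [div_lt_iff₀ hpos] at hi
  have h3 : |seqValue p (shift d (n + i)) - r (n + i)| ≤ 1 / (p - 1) + B := by
    refine (abs_sub _ _).trans (add_le_add ?_ (hB _))
    rw [abs_of_nonneg (seqValue_nonneg hp _)]
    exact seqValue_le hp _
  rw [key, abs_mul, abs_of_pos (pow_pos h0 i)] at h3
  linarith

theorem exists_expansion {p y : ℝ} (hp : 1 < p) (hp2 : p ≤ 2) (hy : 0 ≤ y) (hy' : y ≤ 1 / (p - 1)) :
    ∃ d : BinSeq, seqValue p d = y := by
  have h1 : 0 < p - 1 := by linarith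
  classical
  let r : ℕ → ℝ := fun n => Nat.rec y (fun _ x => if 1 ≤ p * x then p * x - 1 else p * x) n
  let d : BinSeq := fun n => if 1 ≤ p * r n then 1 else 0
  have hrs : ∀ i, r (i + 1) = if 1 ≤ p * r i then p * r i - 1 else p * r i := fun i => rfl
  have hr : ∀ i, r (i + 1) = p * r i - ((d i : ℕ) : ℝ) := by
    intro i
    rw [hrs]
    by_cases h : 1 ≤ p * r i <;> simp [d, h]
  have hb : ∀ i, 0 ≤ r i ∧ r i ≤ 1 / (p - 1) := by
    intro i
    induction i with
    | zero => exact ⟨hy, hy'⟩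
    | succ i ih =>
      rw [hrs]
      obtain ⟨ha, hb⟩ := ih
      rw [le_div_iff₀ h1] at hb ⊢
      split_ifs with h
      · constructor
        · linarith
        · nlinarith
      · push Not at h
        constructor
        · positivity
        · nlinarith
  refine ⟨d, ?_⟩
  have := seqValue_of_remainders (B := 1 / (p - 1)) hp hr
    (fun i => by rw [abs_of_nonneg (hb i).1]; exact (hb i).2) 0
  rwa [shift_zero] at this

/-- The quasi-greedy expansion of `1`, described by its tail values. -/
theorem exists_quasiGreedy {p : ℝ} (hp : 1 < p) (hp2 : p ≤ 2) :
    ∃ d : BinSeq, seqValue p d = 1 ∧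
      ∀ i, 0 < seqValue p (shift d i) ∧ seqValue p (shift d i) ≤ 1 := by
  classical
  -- The strict inequality 1 < p x keeps the remainders positive; this makes the algorithm
  -- quasi-greedy rather than greedy.
  let r : ℕ → ℝ := fun n => Nat.rec 1 (fun _ x => if 1 < p * x then p * x - 1 else p * x) n
  let d : BinSeq := fun n => if 1 < p * r n then 1 else 0
  have hrs : ∀ i, r (i + 1) = if 1 < p * r i then p * r i - 1 else p * r i := fun i => rfl
  have hr : ∀ i, r (i + 1) = p * r i - ((d i : ℕ) : ℝ) := by
    intro i
    rw [hrs]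
    by_cases h : 1 < p * r i <;> simp [d, h]
  have hb : ∀ i, 0 < r i ∧ r i ≤ 1 := by
    intro i
    induction i with
    | zero => exact ⟨one_pos, le_rfl⟩
    | succ i ih =>
      rw [hrs]
      obtain ⟨ha, hb⟩ := ih
      split_ifs with h
      · constructor
        · linarith
        · nlinarith
      · push Not at h
        exact ⟨by positivity, h⟩
  have key := fun n => seqValue_of_remainders (B := 1) hp hr
    (fun i => by rw [abs_of_pos (hb i).1]; exact (hb i).2) n
  refine ⟨d, ?_, fun i => by rw [key]; exact hb i⟩
  have := key 0
  rwa [shift_zero] at this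

/-! ### Unique expansions through the values of tails -/

/-- The conditions on the values of the tails that characterize unique expansions. -/
def IsUnivoque (q : ℝ) (d : BinSeq) : Prop :=
  ∀ i, (d i = 0 → seqValue q (shift d (i + 1)) < 1) ∧
    (d i = 1 → seqValue q (reflectSeq (shift d (i + 1))) < 1)

theorem IsUnivoque.tail {q : ℝ} {d : BinSeq} (h : IsUnivoque q d) (k : ℕ) :
    IsUnivoque q (shift d k) := fun i => by
  rw [shift_shift]; exact h (k + i)

theorem IsUnivoque.eq_of_seqValue_eq {q : ℝ} (hq : 1 < q) {d e : BinSeq} (h : IsUnivoque q d)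
    (he : seqValue q e = seqValue q d) : e = d := by
  have h0 : 0 < q := by linarith
  rcases lexLT_trichotomy e d with h1 | ⟨k, hk, hk0, hk1⟩ | ⟨k, hk, hk0, hk1⟩
  · exact h1
  · have h2 := seqValue_sub_of_first_diff hq hk hk0 hk1
    rw [he, sub_self, eq_comm, div_eq_zero_iff] at h2
    have h3 := (h k).2 hk1
    rw [seqValue_reflectSeq hq] at h3
    have h4 := seqValue_le hq (shift e (k + 1))
    rcases h2 with h2 | h2
    · linarith
    · exact absurd h2 (by positivity)
  · have h2 := seqValue_sub_of_first_diff hq hk hk0 hk1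
    rw [he, sub_self, eq_comm, div_eq_zero_iff] at h2
    have h3 := (h k).1 hk0
    have h4 := seqValue_nonneg hq (shift e (k + 1))
    rcases h2 with h2 | h2
    · linarith
    · exact absurd h2 (by positivity)

/-- Replaces the digit with index `k` by `b` and the digits after it by `e`. -/
def splice (d : BinSeq) (k : ℕ) (b : Fin 2) (e : BinSeq) : BinSeq :=
  fun i => if i < k then d i else if i = k then b else e (i - (k + 1))

theorem seqValue_splice {q : ℝ} (hq : 1 < q) (d : BinSeq) (k : ℕ) (b : Fin 2) (e : BinSeq) :
    seqValue q (splice d k b e) = prefixValue q d k +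
      (((b : ℕ) : ℝ) + seqValue q e) / q / q ^ k := by
  rw [seqValue_split hq _ k, seqValue_succ hq (shift _ k), shift_shift]
  congr 1
  · exact prefixValue_congr fun i hi => by simp [splice, hi]
  · have h1 : (shift (splice d k b e) k) 0 = b := by simp [shift, splice]
    have h2 : shift (splice d k b e) (k + 1) = e := by
      funext i
      simp only [shift, splice]
      rw [if_neg (by omega), if_neg (by omega)]
      congr 1; omega
    rw [h1, h2]

/-- If the condition fails at a digit, the opposite digit leaves a remainder in [0, 1/(q-1)], which
can be expanded again and yields a second expansion. -/
theorem isUnivoque_of_unique {q : ℝ} (hq : 1 < q) (hq2 : q ≤ 2) {d : BinSeq}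
    (h : ∀ e : BinSeq, seqValue q e = seqValue q d → e = d) : IsUnivoque q d := by
  have h0 : 0 < q := by linarith
  have h1 : 0 < q - 1 := by linarith
  have key : ∀ k (b : Fin 2) (y : ℝ), 0 ≤ y → y ≤ 1 / (q - 1) → d k ≠ b →
      ((b : ℕ) : ℝ) + y = ((d k : ℕ) : ℝ) + seqValue q (shift d (k + 1)) → False := by
    intro k b y hy hy' hb hval
    obtain ⟨e, he⟩ := exists_expansion hq hq2 hy hy'
    have h2 : splice d k b e = d := by
      apply h
      rw [seqValue_splice hq, he, hval, seqValue_split hq d k, seqValue_succ hq (shift d k),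
        shift_shift]
      simp [shift]
    apply hb
    conv_lhs => rw [← h2]
    simp [splice]
  intro i
  have h3 := seqValue_le hq (shift d (i + 1))
  have h4 := seqValue_nonneg hq (shift d (i + 1))
  constructor
  · intro hd
    by_contra hc
    push Not at hc
    refine key i 1 (seqValue q (shift d (i + 1)) - 1) (by linarith) (by linarith)
      (by rw [hd]; decide) (by simp [hd])
  · intro hd
    by_contra hc
    push Not at hc
    rw [seqValue_reflectSeq hq] at hc
    refine key i 0 (seqValue q (shift d (i + 1)) + 1) (by linarith) (by linarith)
      (by rw [hd]; decide) (by simp [hd]; ring)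

theorem mem_univoqueBases_iff {p x : ℝ} :
    p ∈ univoqueBases x ↔ 1 < p ∧ p ≤ 2 ∧ ∃ d, IsUnivoque p d ∧ seqValue p d = x := by
  constructor
  · rintro ⟨h1, h2, d, hd, hu⟩
    rw [isExpansion_iff h1] at hd
    refine ⟨h1, h2, d, isUnivoque_of_unique h1 h2 fun e he => ?_, hd⟩
    exact hu e ((isExpansion_iff h1 e).2 (he.trans hd))
  · rintro ⟨h1, h2, d, hd, hx⟩
    refine ⟨h1, h2, d, (isExpansion_iff h1 d).2 hx, fun e he => ?_⟩
    exact hd.eq_of_seqValue_eq h1 (((isExpansion_iff h1 e).1 he).trans hx.symm)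

/-! ### Combinatorics of the sequences θ(a) -/

/-- The combinatorial properties of the sequences `θ(a)` generated by admissible words of
length `m`. -/
structure IsDoubling (θ : BinSeq) (m : ℕ) : Prop where
  pos : 0 < m
  flip : ∀ N i, i + 1 < 2 ^ N * m → θ (2 ^ N * m + i) = 1 - θ i
  last : ∀ N, θ (2 ^ N * m - 1) = 1
  shift_lt : ∀ i, 0 < i → LexLT (shift θ i) θ
  lt_shift : ∀ i, LexLT (reflectSeq θ) (shift θ i)

theorem plusWord_length {w : List (Fin 2)} (hw : w ≠ []) : (plusWord w).length = w.length := by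
  have := List.length_pos_of_ne_nil hw
  simp [plusWord]; omega

theorem plusWord_getD {w : List (Fin 2)} {i : ℕ} (hi : i + 1 < w.length) :
    (plusWord w).getD i 0 = w.getD i 0 := by
  unfold plusWord
  rw [List.getD_append _ _ _ _ (by simp; omega)]
  rw [List.getD_eq_getElem _ _ (by simp; omega), List.getD_eq_getElem _ _ (by omega)]
  simp

theorem plusWord_getD_last (w : List (Fin 2)) :
    (plusWord w).getD (w.length - 1) 0 = 1 := by
  unfold plusWord
  rw [List.getD_append_right _ _ _ _ (by simp)]
  simp

theorem reflectWord_getD {w : List (Fin 2)} {i : ℕ} (hi : i < w.length) :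
    (reflectWord w).getD i 0 = 1 - w.getD i 0 := by
  unfold reflectWord
  rw [List.getD_eq_getElem _ _ (by simpa using hi), List.getD_eq_getElem _ _ hi]
  simp

theorem reflectWord_length (w : List (Fin 2)) : (reflectWord w).length = w.length := by
  simp [reflectWord]

theorem thetaWord_length {a : List (Fin 2)} (ha : a ≠ []) (N : ℕ) :
    (thetaWord a N).length = 2 ^ N * a.length := by
  have h0 := List.length_pos_of_ne_nil ha
  induction N with
  | zero => simp [thetaWord, plusWord_length ha]
  | succ N ih =>
    have : reflectWord (thetaWord a N) ≠ [] := by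
      rw [← List.length_pos_iff_ne_nil, reflectWord_length, ih]; positivity
    rw [thetaWord, List.length_append, plusWord_length this, reflectWord_length, ih]
    ring

theorem thetaWord_getD_add {a : List (Fin 2)} (ha : a ≠ []) {N i : ℕ} (k : ℕ)
    (hi : i < 2 ^ N * a.length) :
    (thetaWord a (N + k)).getD i 0 = (thetaWord a N).getD i 0 := by
  induction k with
  | zero => rfl
  | succ k ih =>
    rw [← ih, ← add_assoc, thetaWord, List.getD_append]
    rw [thetaWord_length ha]
    exact hi.trans_le (Nat.mul_le_mul_right _ (Nat.pow_le_pow_right (by norm_num) (by omega)))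

theorem thetaSeq_eq_getD {a : List (Fin 2)} (ha : a ≠ []) {N i : ℕ}
    (hi : i < 2 ^ N * a.length) : thetaSeq a i = (thetaWord a N).getD i 0 := by
  have h0 := List.length_pos_of_ne_nil ha
  have h1 : i < 2 ^ i * a.length := Nat.lt_two_pow_self.trans_le (Nat.le_mul_of_pos_right _ h0)
  unfold thetaSeq
  rw [← thetaWord_getD_add ha N h1, add_comm, thetaWord_getD_add ha i hi]

theorem thetaSeq_last {a : List (Fin 2)} (ha : a ≠ []) (N : ℕ) :
    thetaSeq a (2 ^ N * a.length - 1) = 1 := by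
  have h0 := List.length_pos_of_ne_nil ha
  have h1 : 0 < 2 ^ N * a.length := by positivity
  rw [thetaSeq_eq_getD ha (N := N) (by omega)]
  cases N with
  | zero => simpa [thetaWord] using plusWord_getD_last a
  | succ N =>
    have h2 : 0 < 2 ^ N * a.length := by positivity
    have h5 : 2 ^ (N + 1) * a.length = 2 ^ N * a.length + 2 ^ N * a.length := by ring
    have h4 := plusWord_getD_last (reflectWord (thetaWord a N))
    rw [reflectWord_length, thetaWord_length ha] at h4
    rw [thetaWord, List.getD_append_right _ _ _ _ (by rw [thetaWord_length ha]; omega),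
      thetaWord_length ha, ← h4]
    congr 1
    omega

theorem thetaSeq_flip {a : List (Fin 2)} (ha : a ≠ []) (N i : ℕ) (hi : i + 1 < 2 ^ N * a.length) :
    thetaSeq a (2 ^ N * a.length + i) = 1 - thetaSeq a i := by
  have h5 : 2 ^ (N + 1) * a.length = 2 ^ N * a.length + 2 ^ N * a.length := by ring
  rw [thetaSeq_eq_getD ha (N := N) (i := i) (by omega),
    thetaSeq_eq_getD ha (N := N + 1) (by omega), thetaWord,
    List.getD_append_right _ _ _ _ (by rw [thetaWord_length ha]; omega), thetaWord_length ha,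
    plusWord_getD (by rw [reflectWord_length, thetaWord_length ha]; omega),
    reflectWord_getD (by rw [thetaWord_length ha]; omega)]
  congr 2
  omega

theorem thetaSeq_prefix {a : List (Fin 2)} (ha : a ≠ []) {i : ℕ} (hi : i + 1 < a.length) :
    thetaSeq a i = a.getD i 0 := by
  rw [thetaSeq_eq_getD ha (N := 0) (by omega), thetaWord, plusWord_getD hi]

/-- The words of length `M` starting `θ` satisfy the lexicographic conditions. -/
def PrefixAdmissible (θ : BinSeq) (M : ℕ) : Prop :=
  ∀ i, 0 < i → i < M →
    (∃ k, i + k < M ∧ (∀ t < k, θ (i + t) = 1 - θ t) ∧ θ (i + k) = 1 ∧ θ k = 1) ∧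
    ((∀ t, i + t < M → θ (i + t) = θ t) ∨
      ∃ k, i + k < M ∧ (∀ t < k, θ (i + t) = θ t) ∧ θ (i + k) = 0 ∧ θ k = 1)

theorem fin_two_lt {x y : Fin 2} : x < y ↔ x = 0 ∧ y = 1 := by
  revert x y; decide

theorem IsAdmissible.lower {a : List (Fin 2)} (h : IsAdmissible a) {i : ℕ} (hi : 0 < i)
    (hia : i < a.length) : (∀ t, i + t < a.length → a.getD (i + t) 0 = 1 - a.getD t 0) ∨
      ∃ k, i + k < a.length ∧ (∀ t < k, a.getD (i + t) 0 = 1 - a.getD t 0) ∧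
        a.getD (i + k) 0 = 1 ∧ a.getD k 0 = 1 := by
  have h1 := (h.2 i hi hia).1
  rw [le_iff_eq_or_lt, List.lt_iff_exists] at h1
  rcases h1 with h1 | ⟨-, h1⟩ | ⟨k, hk1, hk2, hk3, hk4⟩
  · left
    intro t ht
    have h2 := congrArg (fun l : List (Fin 2) => l.getD t 0) h1
    simp only [reflectWord] at h2
    rw [List.getD_eq_getElem _ _ (by simp; omega), List.getD_eq_getElem _ _ (by simp; omega)] at h2
    simp at h2
    rw [List.getD_eq_getElem _ _ ht, List.getD_eq_getElem _ _ (by omega), h2]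
  · simp [reflectWord_length] at h1
  · right
    simp [reflectWord] at hk1 hk2 hk3 hk4
    rw [fin_two_lt] at hk4
    refine ⟨k, by omega, fun t ht => ?_, ?_, ?_⟩
    · rw [List.getD_eq_getElem _ _ (by omega), List.getD_eq_getElem _ _ (by omega), hk3 t ht]
    · rw [List.getD_eq_getElem _ _ (by omega), hk4.2]
    · rw [List.getD_eq_getElem _ _ (by omega)]
      have := hk4.1
      rw [← one_sub_one_sub_fin_two (a[k]), this]; rfl

theorem IsAdmissible.upper {a : List (Fin 2)} (h : IsAdmissible a) {i : ℕ} (hi : 0 < i)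
    (hia : i < a.length) : ∃ k, i + k < a.length ∧ (∀ t < k, a.getD (i + t) 0 = a.getD t 0) ∧
        a.getD (i + k) 0 = 0 ∧ a.getD k 0 = 1 := by
  have h1 := (h.2 i hi hia).2
  rw [List.lt_iff_exists] at h1
  rcases h1 with ⟨-, h1⟩ | ⟨k, hk1, hk2, hk3, hk4⟩
  · simp at h1
  · simp at hk1 hk2 hk3 hk4
    rw [fin_two_lt] at hk4
    refine ⟨k, by omega, fun t ht => ?_, ?_, ?_⟩
    · rw [List.getD_eq_getElem _ _ (by omega), List.getD_eq_getElem _ _ (by omega), hk3 t ht]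
    · rw [List.getD_eq_getElem _ _ (by omega), hk4.1]
    · rw [List.getD_eq_getElem _ _ (by omega), hk4.2]

theorem IsAdmissible.head_last {a : List (Fin 2)} (h : IsAdmissible a) (ha : 1 < a.length) :
    a.getD 0 0 = 1 ∧ a.getD (a.length - 1) 0 = 0 := by
  obtain ⟨k, hk, -, h0, h1⟩ := h.upper (i := a.length - 1) (by omega) (by omega)
  obtain rfl : k = 0 := by omega
  exact ⟨h1, h0⟩

/-- Raising the last digit from 0 to 1 interchanges weak and strict: a tie with the reflected prefix
becomes a strict inequality, and an upper inequality decided only at the last digit becomes a tie.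
-/
theorem IsAdmissible.prefixAdmissible {a : List (Fin 2)} (h : IsAdmissible a) :
    PrefixAdmissible (thetaSeq a) a.length := by
  have ha := h.1
  have hlast : thetaSeq a (a.length - 1) = 1 := by simpa using thetaSeq_last ha 0
  have hpre : ∀ t, t + 1 < a.length → thetaSeq a t = a.getD t 0 := fun t => thetaSeq_prefix ha
  intro i hi hia
  have hl0 := (h.head_last (by omega)).2
  constructor
  · rcases h.lower hi hia with hl | ⟨k, hk, hkt, hk0, hk1⟩
    · refine ⟨a.length - 1 - i, by omega, fun t ht => ?_, ?_, ?_⟩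
      · rw [hpre _ (by omega), hpre _ (by omega), hl _ (by omega)]
      · rw [← hlast]; congr 1; omega
      · have h2 := hl (a.length - 1 - i) (by omega)
        rw [show i + (a.length - 1 - i) = a.length - 1 by omega, hl0] at h2
        rw [hpre _ (by omega), ← one_sub_one_sub_fin_two (a.getD _ 0), ← h2]; rfl
    · have hne : i + k ≠ a.length - 1 := by
        intro hc; rw [hc, hl0] at hk0; exact absurd hk0 (by decide)
      refine ⟨k, hk, fun t ht => ?_, ?_, ?_⟩
      · rw [hpre _ (by omega), hpre _ (by omega), hkt _ ht]
      · rw [hpre _ (by omega), hk0]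
      · rw [hpre _ (by omega), hk1]
  · obtain ⟨k, hk, hkt, hk0, hk1⟩ := h.upper hi hia
    by_cases hne : i + k = a.length - 1
    · left
      intro t ht
      rcases lt_or_eq_of_le (show t ≤ k by omega) with h1 | rfl
      · rw [hpre _ (by omega), hpre _ (by omega), hkt _ h1]
      · rw [hne, hlast, hpre _ (by omega), hk1]
    · right
      refine ⟨k, hk, fun t ht => ?_, ?_, ?_⟩
      · rw [hpre _ (by omega), hpre _ (by omega), hkt _ ht]
      · rw [hpre _ (by omega), hk0]
      · rw [hpre _ (by omega), hk1]

/-- If the digits from i to M tie with the prefix, the comparison goes on between the reflection of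
θ, which follows at M, and the tail of θ at M - i. The lower condition at M - i decides it. -/
theorem PrefixAdmissible.exists_lt {θ : BinSeq} {M : ℕ} (h : PrefixAdmissible θ M)
    (hflip : ∀ i, i + 1 < M → θ (M + i) = 1 - θ i) {i : ℕ} (hi : 0 < i) (hlt : i < M) :
    ∃ k, i + k < 2 * M ∧ (∀ t < k, θ (i + t) = θ t) ∧ θ (i + k) = 0 ∧ θ k = 1 := by
  obtain ⟨-, h2⟩ := h i hi hlt
  rcases h2 with h2 | ⟨k, hk, hkt, hk0, hk1⟩
  · obtain ⟨⟨k, hk, hkt, hk0, hk1⟩, -⟩ := h (M - i) (by omega) (by omega)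
    refine ⟨M - i + k, by omega, fun t ht => ?_, ?_, hk0⟩
    · by_cases htM : i + t < M
      · exact h2 t htM
      · have h3 := hflip (i + t - M) (by omega)
        have h4 := hkt (i + t - M) (by omega)
        rw [show M + (i + t - M) = i + t by omega] at h3
        rw [show M - i + (i + t - M) = t by omega] at h4
        rw [h3, h4]
    · have h3 := hflip k (by omega)
      rw [show i + (M - i + k) = M + k by omega, h3, hk1]; rfl
  · exact ⟨k, by omega, hkt, hk0, hk1⟩

/-- The lexicographic conditions pass from the prefix `w` to the prefix `w (reflection of w)⁺`. -/
theorem PrefixAdmissible.double {θ : BinSeq} {M : ℕ} (h : PrefixAdmissible θ M)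
    (h0 : θ 0 = 1) (hflip : ∀ i, i + 1 < M → θ (M + i) = 1 - θ i) (hlast : θ (M - 1) = 1)
    (hlast' : θ (2 * M - 1) = 1) : PrefixAdmissible θ (2 * M) := by
  intro i hi hiM
  rcases lt_trichotomy i M with hlt | rfl | hgt
  · obtain ⟨⟨k, hk, hkt, hk0, hk1⟩, -⟩ := h i hi hlt
    exact ⟨⟨k, by omega, hkt, hk0, hk1⟩, Or.inr (h.exists_lt hflip hi hlt)⟩
  · refine ⟨⟨i - 1, by omega, fun t ht => hflip t (by omega), ?_, hlast⟩, ?_⟩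
    · rw [← hlast']; congr 1; omega
    · by_cases h1 : i = 1
      · subst h1
        left
        intro t ht
        obtain rfl : t = 0 := by omega
        rw [h0]; exact hlast'
      · right
        refine ⟨0, by omega, fun t ht => absurd ht (by omega), ?_, h0⟩
        rw [hflip 0 (by omega), h0]; rfl
  -- In the second block all digits but the last are reflected, so the old upper condition gives the
  -- new lower one and conversely; the raised last digit settles the boundary cases.
  · have hi' : i = M + (i - M) := by omega
    obtain ⟨⟨k, hk, hkt, hk0, hk1⟩, h2⟩ := h (i - M) (by omega) (by omega)
    have hf : ∀ t, i + t + 1 < 2 * M → θ (i + t) = 1 - θ (i - M + t) := fun t ht => by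
      rw [← hflip _ (by omega)]; congr 1; omega
    have hend : θ (i + (2 * M - 1 - i)) = 1 := by rw [← hlast']; congr 1; omega
    constructor
    · rcases h2 with h2 | ⟨l, hl, hlt, hl0, hl1⟩
      · refine ⟨2 * M - 1 - i, by omega, fun t ht => ?_, hend, ?_⟩
        · rw [hf t (by omega), h2 t (by omega)]
        · rw [← h2 _ (by omega), ← hlast]; congr 1; omega
      · by_cases hc : i + l = 2 * M - 1
        · exfalso
          rw [show i - M + l = M - 1 by omega, hlast] at hl0
          exact absurd hl0 (by decide)
        · refine ⟨l, by omega, fun t ht => ?_, ?_, hl1⟩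
          · rw [hf t (by omega), hlt t ht]
          · rw [hf l (by omega), hl0]; rfl
    · by_cases hc : i + k = 2 * M - 1
      · left
        intro t ht
        rcases lt_or_eq_of_le (show t ≤ k by omega) with h3 | rfl
        · rw [hf t (by omega), hkt t h3, one_sub_one_sub_fin_two]
        · rw [hk1, hc, hlast']
      · right
        refine ⟨k, by omega, fun t ht => ?_, ?_, hk1⟩
        · rw [hf t (by omega), hkt t ht, one_sub_one_sub_fin_two]
        · rw [hf k (by omega), hk0]; rfl

theorem IsAdmissible.isDoubling {a : List (Fin 2)} (h : IsAdmissible a) :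
    IsDoubling (thetaSeq a) a.length := by
  have ha := h.1
  have hpos := List.length_pos_of_ne_nil ha
  have hlast := thetaSeq_last ha
  have hflip := thetaSeq_flip ha
  have h0 : thetaSeq a 0 = 1 := by
    by_cases h1 : a.length = 1
    · have := hlast 0
      rwa [h1] at this
    · rw [thetaSeq_prefix ha (by omega)]; exact (h.head_last (by omega)).1
  have hpa : ∀ N, PrefixAdmissible (thetaSeq a) (2 ^ N * a.length) := by
    intro N
    induction N with
    | zero => simpa using h.prefixAdmissible
    | succ N ih =>
      have h1 : 2 ^ (N + 1) * a.length = 2 * (2 ^ N * a.length) := by ring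
      rw [h1]
      refine ih.double h0 (fun i => hflip N i) (hlast N) ?_
      rw [← h1]; exact hlast _
  have hlt : ∀ i, i < 2 ^ i * a.length :=
    fun i => Nat.lt_two_pow_self.trans_le (Nat.le_mul_of_pos_right _ hpos)
  refine ⟨hpos, hflip, hlast, fun i hi => ?_, fun i => ?_⟩
  · obtain ⟨k, -, hkt, hk0, hk1⟩ := (hpa i).exists_lt (fun j => hflip i j) hi (hlt i)
    exact ⟨k, hkt, hk0, hk1⟩
  · rcases Nat.eq_zero_or_pos i with rfl | hi
    · exact ⟨0, fun t ht => absurd ht (by omega), by simp [reflectSeq, h0], by simpa [shift] using h0⟩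
    · obtain ⟨⟨k, hk, hkt, hk0, hk1⟩, -⟩ := hpa i i hi (hlt i)
      exact ⟨k, fun t ht => (hkt t ht).symm, by simp [reflectSeq, hk1], hk0⟩

/-! ### From lexicographic inequalities to values below 1 -/

/-- If every member of `T` first differs from an expansion `θ` of `1` at a digit where it is
smaller, with the remaining tail again in `T`, then all values of members of `T` are below `1`. -/
theorem seqValue_lt_one_of_family {q : ℝ} (hq : 1 < q) {θ : BinSeq} (hθ : seqValue q θ = 1)
    (hones : ∀ k, ∃ i, k ≤ i ∧ θ i = 1) {T : Set BinSeq}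
    (hT : ∀ z ∈ T, ∃ k, (∀ i < k, z i = θ i) ∧ z k = 0 ∧ θ k = 1 ∧ shift z (k + 1) ∈ T) :
    ∀ z ∈ T, seqValue q z < 1 := by
  have h0 : 0 < q := by linarith
  have h1 : 0 < q - 1 := by linarith
  -- Each branching improves the upper bound for the excess over 1 by a factor of at least q,
  -- starting from the trivial bound 1/(q-1).
  have hbound : ∀ n : ℕ, ∀ z ∈ T, seqValue q z - 1 ≤ 1 / (q - 1) / q ^ n := by
    intro n
    induction n with
    | zero =>
      intro z _
      have := seqValue_le hq z
      simp at this ⊢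
      linarith
    | succ n ih =>
      intro z hz
      obtain ⟨k, hk, hk0, hk1, hk2⟩ := hT z hz
      have h2 := seqValue_sub_of_first_diff hq hk hk0 hk1
      rw [hθ] at h2
      have h3 := ih _ hk2
      have h4 := seqValue_nonneg hq (shift θ (k + 1))
      have h5 : seqValue q z - 1
          = (seqValue q (shift z (k + 1)) - 1 - seqValue q (shift θ (k + 1))) / q ^ (k + 1) := by
        rw [← neg_inj, neg_sub, h2, ← neg_div]; ring
      rw [h5]
      calc _ ≤ (1 / (q - 1) / q ^ n) / q ^ (k + 1) := by gcongr; linarith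
        _ ≤ (1 / (q - 1) / q ^ n) / q := by
          gcongr
          exact le_self_pow₀ hq.le (by omega)
        _ = _ := by rw [pow_succ]; field_simp
  have hle : ∀ z ∈ T, seqValue q z ≤ 1 := by
    intro z hz
    by_contra hc
    push Not at hc
    have hc' : 0 < seqValue q z - 1 := by linarith
    obtain ⟨n, hn⟩ := pow_unbounded_of_one_lt (1 / (q - 1) / (seqValue q z - 1)) hq
    rw [div_lt_iff₀ hc'] at hn
    have := hbound n z hz
    rw [le_div_iff₀ (by positivity)] at this
    linarith
  -- One more branching makes the inequality strict, since θ has a 1 beyond the branching digit.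
  intro z hz
  obtain ⟨k, hk, hk0, hk1, hk2⟩ := hT z hz
  have h2 := seqValue_sub_of_first_diff hq hk hk0 hk1
  rw [hθ] at h2
  have h3 := hle _ hk2
  obtain ⟨i, hi, hi1⟩ := hones (k + 1)
  have h4 : 0 < seqValue q (shift θ (k + 1)) := by
    refine seqValue_pos hq (k := i - (k + 1)) ?_
    rw [← hi1]; simp only [shift]; congr 1; omega
  have h5 : 0 < (1 + seqValue q (shift θ (k + 1)) - seqValue q (shift z (k + 1))) / q ^ (k + 1) :=
    div_pos (by linarith) (by positivity)
  linarith

theorem IsDoubling.head {θ : BinSeq} {m : ℕ} (h : IsDoubling θ m) : θ 0 = 1 := by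
  obtain ⟨k, hk, hk0, hk1⟩ := h.shift_lt 1 one_pos
  rcases fin_two_cases (θ 0) with h0 | h0
  · have h2 : ∀ i, i ≤ k → θ i = 0 := by
      intro i
      induction i with
      | zero => intro _; exact h0
      | succ i ih =>
        intro hi
        have := hk i (by omega)
        simp only [shift] at this
        rw [add_comm, this]
        exact ih (by omega)
    rw [h2 k le_rfl] at hk1
    exact absurd hk1 (by decide)
  · exact h0

theorem IsDoubling.exists_one {θ : BinSeq} {m : ℕ} (h : IsDoubling θ m) (k : ℕ) :
    ∃ i, k ≤ i ∧ θ i = 1 := by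
  refine ⟨_, ?_, h.last k⟩
  have h1 : k < 2 ^ k * m := Nat.lt_two_pow_self.trans_le (Nat.le_mul_of_pos_right _ h.pos)
  omega

theorem IsDoubling.seqValue_shift_lt_one {q : ℝ} (hq : 1 < q) {θ : BinSeq} {m : ℕ}
    (h : IsDoubling θ m) (hθ : seqValue q θ = 1) {i : ℕ} (hi : 0 < i) :
    seqValue q (shift θ i) < 1 := by
  refine seqValue_lt_one_of_family hq hθ h.exists_one (T := {z | ∃ i, 0 < i ∧ z = shift θ i}) ?_ _
    ⟨i, hi, rfl⟩
  rintro z ⟨l, hl, rfl⟩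
  obtain ⟨k, hk, hk0, hk1⟩ := h.shift_lt l hl
  exact ⟨k, hk, hk0, hk1, l + (k + 1), by omega, shift_shift _ _ _⟩

theorem IsDoubling.seqValue_reflectSeq_shift_lt_one {q : ℝ} (hq : 1 < q) {θ : BinSeq} {m : ℕ}
    (h : IsDoubling θ m) (hθ : seqValue q θ = 1) (i : ℕ) :
    seqValue q (reflectSeq (shift θ i)) < 1 := by
  refine seqValue_lt_one_of_family hq hθ h.exists_one
    (T := {z | ∃ i, z = reflectSeq (shift θ i)}) ?_ _ ⟨i, rfl⟩
  rintro z ⟨l, rfl⟩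
  have h1 := (h.lt_shift l).reflect
  rw [reflectSeq_reflectSeq] at h1
  obtain ⟨k, hk, hk0, hk1⟩ := h1
  refine ⟨k, hk, hk0, hk1, l + (k + 1), ?_⟩
  rw [← reflectSeq_shift, shift_shift]

theorem IsDoubling.isUnivoque {q : ℝ} (hq : 1 < q) {θ : BinSeq} {m : ℕ}
    (h : IsDoubling θ m) (hθ : seqValue q θ = 1) : IsUnivoque q θ := fun _ =>
  ⟨fun _ => h.seqValue_shift_lt_one hq hθ (by omega),
    fun _ => h.seqValue_reflectSeq_shift_lt_one hq hθ _⟩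

/-! ### Lexicographic conditions in a smaller base -/

theorem lexLT_of_seqValue_lt_one {p : ℝ} (hp : 1 < p) {β y : BinSeq} (hβ : seqValue p β = 1)
    (hβ' : ∀ i, seqValue p (shift β i) ≤ 1) (hy : seqValue p y < 1) : LexLT y β := by
  have h0 : 0 < p := by linarith
  rcases lexLT_trichotomy y β with rfl | h | ⟨k, hk, hk0, hk1⟩
  · linarith
  · exact h
  · exfalso
    have h1 := seqValue_sub_of_first_diff hp hk hk0 hk1
    have h2 := seqValue_nonneg hp (shift y (k + 1))
    have h3 := hβ' (k + 1)
    have h4 : 0 ≤ (1 + seqValue p (shift y (k + 1)) - seqValue p (shift β (k + 1))) / p ^ (k + 1) :=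
      div_nonneg (by linarith) (by positivity)
    linarith

theorem not_lexLT_shift_of_quasiGreedy {p : ℝ} (hp : 1 < p) {β : BinSeq} (hβ : seqValue p β = 1)
    (hβ' : ∀ i, 0 < seqValue p (shift β i) ∧ seqValue p (shift β i) ≤ 1) (i : ℕ) :
    ¬ LexLT β (shift β i) := by
  rintro ⟨k, hk, hk0, hk1⟩
  have h0 : 0 < p := by linarith
  have h1 := seqValue_sub_of_first_diff hp hk hk0 hk1
  rw [shift_shift] at h1
  have h2 := (hβ' (i + (k + 1))).1
  have h3 := (hβ' (k + 1)).2
  have h4 := (hβ' i).2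
  have h5 : 0 < (1 + seqValue p (shift β (i + (k + 1))) - seqValue p (shift β (k + 1)))
      / p ^ (k + 1) := div_pos (by linarith) (by positivity)
  linarith

/-- If β were above θ, its value in base q would exceed 1, because proper tails of θ have value
below 1; but values decrease as the base grows. -/
theorem IsDoubling.quasiGreedy_lexLT {p q : ℝ} (hp : 1 < p) (hpq : p < q) {θ β : BinSeq} {m : ℕ}
    (h : IsDoubling θ m) (hθ : seqValue q θ = 1) (hβ : seqValue p β = 1) : LexLT β θ := by
  have hq := hp.trans hpq
  have h0 : 0 < q := by linarith
  rcases lexLT_trichotomy β θ with rfl | h1 | ⟨k, hk, hk0, hk1⟩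
  · have := seqValue_strictAnti hp hpq h.head
    linarith
  · exact h1
  · exfalso
    have h1 := seqValue_sub_of_first_diff hq hk hk0 hk1
    have h2 := seqValue_nonneg hq (shift β (k + 1))
    have h3 := h.seqValue_shift_lt_one hq hθ (i := k + 1) (by omega)
    have h4 : 0 < (1 + seqValue q (shift β (k + 1)) - seqValue q (shift θ (k + 1))) / q ^ (k + 1) :=
      div_pos (by linarith) (by positivity)
    have h5 := seqValue_anti hp hpq.le β
    linarith

/-- The lexicographic conditions of a unique expansion, with respect to the expansion `β` of `1`. -/
def IsLexUnivoque (β c : BinSeq) : Prop :=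
  ∀ i, (c i = 0 → LexLT (shift c (i + 1)) β) ∧ (c i = 1 → LexLT (reflectSeq (shift c (i + 1))) β)

theorem IsLexUnivoque.tail {β c : BinSeq} (h : IsLexUnivoque β c) (k : ℕ) :
    IsLexUnivoque β (shift c k) := fun i => by
  rw [shift_shift]; exact h (k + i)

theorem IsUnivoque.isLexUnivoque {p : ℝ} (hp : 1 < p) {β c : BinSeq} (hβ : seqValue p β = 1)
    (hβ' : ∀ i, seqValue p (shift β i) ≤ 1) (h : IsUnivoque p c) : IsLexUnivoque β c := fun i =>
  ⟨fun hi => lexLT_of_seqValue_lt_one hp hβ hβ' ((h i).1 hi),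
    fun hi => lexLT_of_seqValue_lt_one hp hβ hβ' ((h i).2 hi)⟩

/-! ### Why a sequence cannot branch off below θ -/

/-- The periodic sequence with the prefix of length `l` of `θ` and its reflection alternating. -/
def alternating (θ : BinSeq) (l : ℕ) : BinSeq := fun i =>
  if i / l % 2 = 0 then θ (i % l) else 1 - θ (i % l)

theorem alternating_of_lt (θ : BinSeq) {l i : ℕ} (h : i < l) : alternating θ l i = θ i := by
  simp [alternating, Nat.div_eq_of_lt h, Nat.mod_eq_of_lt h]

theorem alternating_add (θ : BinSeq) {l : ℕ} (hl : 0 < l) (i : ℕ) :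
    alternating θ l (l + i) = 1 - alternating θ l i := by
  unfold alternating
  rw [Nat.add_div_left _ hl, Nat.add_mod_left]
  rcases Nat.mod_two_eq_zero_or_one (i / l) with h | h
  · rw [if_neg (by omega), if_pos h]
  · rw [if_pos (by omega), if_neg (by omega), one_sub_one_sub_fin_two]

/-- Up to index 2l - 2 the alternating sequence agrees with θ, so it lies above β if s < 2l - 1. If
s = 2l - 1 and β exceeded it later, its period 2l would put β below the tail of β at 2l. -/
theorem not_alternating_lexLT {θ β : BinSeq} {l s : ℕ}
    (hflip : ∀ i, i + 1 < l → θ (l + i) = 1 - θ i)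
    (hs : ∀ i < s, β i = θ i) (hs0 : β s = 0) (hs1 : θ s = 1) (hls : l ≤ s) (hsl : s < 2 * l)
    (hβ : ¬ LexLT β (shift β (2 * l))) : ¬ LexLT (alternating θ l) β := by
  have hl : 0 < l := by omega
  have hag : ∀ i, i + 1 < 2 * l → alternating θ l i = θ i := by
    intro i hi
    by_cases h : i < l
    · exact alternating_of_lt θ h
    · obtain ⟨t, rfl⟩ := Nat.exists_eq_add_of_le (not_lt.1 h)
      rw [alternating_add θ hl, alternating_of_lt θ (by omega), hflip t (by omega)]
  intro hlt
  by_cases hs2 : s + 1 < 2 * l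
  · exact hlt.asymm ⟨s, fun i hi => by rw [hs i hi, hag i (by omega)], hs0, by rw [hag s hs2, hs1]⟩
  · obtain ⟨u, hu, hu0, hu1⟩ := hlt
    have hus : s < u := by
      by_contra hc
      rcases lt_or_eq_of_le (not_lt.1 hc) with h1 | rfl
      · rw [hag u (by omega), ← hs u h1, hu1] at hu0
        exact absurd hu0 (by decide)
      · rw [hs0] at hu1; exact absurd hu1 (by decide)
    have hper : ∀ i, alternating θ l (2 * l + i) = alternating θ l i := by
      intro i
      rw [two_mul, add_assoc, alternating_add θ hl, alternating_add θ hl, one_sub_one_sub_fin_two]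
    apply hβ
    refine ⟨u - 2 * l, fun i hi => ?_, ?_, ?_⟩
    · simp only [shift]
      rw [← hu i (by omega), ← hu (2 * l + i) (by omega), hper]
    · rw [← hu _ (by omega), ← hper, ← hu0]; congr 1; omega
    · rw [← hu1]; simp only [shift]; congr 1; omega

/-- A sequence starting with the reflection of a prefix of `θ` of length `l` violates one of two
lexicographic conditions with respect to `β`. -/
theorem not_starts_with_reflection {θ β y : BinSeq} {l s : ℕ} (hl : 0 < l)
    (hflip : ∀ i, i + 1 < l → θ (l + i) = 1 - θ i)
    (hs : ∀ i < s, β i = θ i) (hs0 : β s = 0) (hs1 : θ s = 1) (hsl : s < 2 * l)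
    (hβ : ¬ LexLT β (shift β (2 * l))) (hy : LexLT (reflectSeq y) β)
    (hy' : LexLT (shift y l) β) (hpre : ∀ t < l, y t = 1 - θ t) : False := by
  have hpre' : ∀ t < l, reflectSeq y t = θ t := fun t ht => by
    simp [reflectSeq, hpre t ht]
  by_cases hls : l ≤ s
  · have hγ := not_alternating_lexLT hflip hs hs0 hs1 hls hsl hβ
    have key : ∀ x, LexLT x β → LexLT x (alternating θ l) := by
      intro x hx
      rcases lexLT_trichotomy β (alternating θ l) with h | h | h
      · rwa [← h]
      · exact hx.trans h
      · exact absurd h hγ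
    obtain ⟨k, hk, hk0, hk1⟩ := key _ hy
    have hkl : l ≤ k := by
      by_contra hc
      rw [hpre' k (by omega), ← alternating_of_lt θ (by omega : k < l), hk1] at hk0
      exact absurd hk0 (by decide)
    -- The reflection of y starts with w and lies below γ = w γ̄. Removing w and reflecting puts the
    -- tail of y at l above γ.
    refine (key _ hy').asymm ⟨k - l, fun i hi => ?_, ?_, ?_⟩
    · have h1 := hk (l + i) (by omega)
      rw [alternating_add θ hl] at h1
      simp only [reflectSeq, shift] at h1 ⊢
      rw [← one_sub_one_sub_fin_two (y (l + i)), h1, one_sub_one_sub_fin_two]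
    · have h1 := alternating_add θ hl (k - l)
      rw [show l + (k - l) = k by omega, hk1] at h1
      rw [← one_sub_one_sub_fin_two (alternating θ l (k - l)), ← h1]; rfl
    · simp only [reflectSeq, shift] at hk0 ⊢
      rw [show l + (k - l) = k by omega, ← one_sub_one_sub_fin_two (y k), hk0]; rfl
  · refine hy.asymm ⟨s, fun i hi => ?_, hs0, ?_⟩
    · rw [hs i hi, hpre' i (by omega)]
    · rw [hpre' s (by omega), hs1]

theorem not_below_reflection {θ β y : BinSeq} {k : ℕ} (hβθ : LexLT β θ)
    (hy : LexLT (reflectSeq y) β) (hpre : ∀ t < k, y t = 1 - θ t) (hyk : y k = 0)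
    (hθk : θ k = 0) : False :=
  (hy.trans hβθ).asymm ⟨k, fun t ht => by simp [reflectSeq, hpre t ht], hθk,
    by simp [reflectSeq, hyk]⟩

section Branch

variable {θ β c : BinSeq} {m s N : ℕ}

/-- After its leading 1, c follows the reflection of θ. Either it drops below it within the first l
= 2^N m digits, or it contains the whole reflected prefix of length l, where s < 2l. -/
theorem IsDoubling.no_branch_of_gt (h : IsDoubling θ m)
    (hs : ∀ i < s, β i = θ i) (hs0 : β s = 0) (hs1 : θ s = 1) (hsN : s < 2 ^ (N + 1) * m)
    (hβ : ∀ i, ¬ LexLT β (shift β i)) (hc : IsLexUnivoque β c) {r j : ℕ} (hr : N < r)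
    (hj : 0 < j) (hc0 : c 0 = 1) (hcd : ∀ i < j, c i = θ (2 ^ r * m - 1 + i)) (hcj : c j = 0)
    (hdj : θ (2 ^ r * m - 1 + j) = 1) : False := by
  have hm := h.pos
  have hl : 0 < 2 ^ N * m := by positivity
  have h2 : 2 ^ (N + 1) * m = 2 * (2 ^ N * m) := by ring
  have h3 : 2 ^ (N + 1) * m ≤ 2 ^ r * m :=
    Nat.mul_le_mul_right _ (Nat.pow_le_pow_right (by norm_num) hr)
  have hy := (hc 0).2 hc0
  rw [zero_add] at hy
  have hyt : ∀ t, t + 1 < j → t + 1 < 2 ^ r * m → shift c 1 t = 1 - θ t := by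
    intro t ht ht'
    rw [← h.flip r t ht']
    simp only [shift]
    rw [hcd _ (by omega)]; congr 1; omega
  by_cases hjl : j ≤ 2 ^ N * m
  · refine not_below_reflection (k := j - 1) ⟨s, hs, hs0, hs1⟩ hy
      (fun t ht => hyt t (by omega) (by omega)) ?_ ?_
    · rw [← hcj]; simp only [shift]; congr 1; omega
    · have h4 := h.flip r (j - 1) (by omega)
      rw [show 2 ^ r * m + (j - 1) = 2 ^ r * m - 1 + j by omega, hdj] at h4
      rw [← one_sub_one_sub_fin_two (θ _), ← h4]; rfl
  -- The prefix of θ ends in 1, so the reflected prefix ends in 0, and this 0 yields the condition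
  -- on the tail after it.
  · have h4 : c (2 ^ N * m) = 0 := by
      have h5 := hyt (2 ^ N * m - 1) (by omega) (by omega)
      rw [h.last] at h5
      simp only [shift] at h5
      rwa [show 1 + (2 ^ N * m - 1) = 2 ^ N * m by omega] at h5
    have h5 := (hc _).1 h4
    refine not_starts_with_reflection hl (h.flip N) hs hs0 hs1 (by omega) (hβ _) hy
      ?_ (fun t ht => hyt t (by omega) (by omega))
    rwa [shift_shift, add_comm 1]

theorem IsDoubling.no_branch_of_eq (h : IsDoubling θ m)
    (hs : ∀ i < s, β i = θ i) (hs0 : β s = 0) (hs1 : θ s = 1) (hsN : s < 2 ^ (N + 1) * m)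
    (hβ : ∀ i, ¬ LexLT β (shift β i)) (hc : IsLexUnivoque β c) {j : ℕ}
    (hj : 0 < j) (hc0 : c 0 = 1) (hcd : ∀ i < j, c i = θ (2 ^ N * m - 1 + i)) (hcj : c j = 0)
    (hdj : θ (2 ^ N * m - 1 + j) = 1) : False := by
  have hm := h.pos
  have hl : 0 < 2 ^ N * m := by positivity
  have h2 : 2 ^ (N + 1) * m = 2 * (2 ^ N * m) := by ring
  have hy := (hc 0).2 hc0
  rw [zero_add] at hy
  have hyt : ∀ t, t + 1 < j → t + 1 < 2 ^ N * m → shift c 1 t = 1 - θ t := by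
    intro t ht ht'
    rw [← h.flip N t ht']
    simp only [shift]
    rw [hcd _ (by omega)]; congr 1; omega
  rcases lt_trichotomy j (2 ^ N * m) with hjl | hjl | hjl
  · refine not_below_reflection (k := j - 1) ⟨s, hs, hs0, hs1⟩ hy
      (fun t ht => hyt t (by omega) (by omega)) ?_ ?_
    · rw [← hcj]; simp only [shift]; congr 1; omega
    · have h4 := h.flip N (j - 1) (by omega)
      rw [show 2 ^ N * m + (j - 1) = 2 ^ N * m - 1 + j by omega, hdj] at h4
      rw [← one_sub_one_sub_fin_two (θ _), ← h4]; rfl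
  -- Here θ has the raised last digit 1 of its block; the 0 of c completes the exact reflected
  -- prefix.
  · have h5 := (hc _).1 hcj
    refine not_starts_with_reflection hl (h.flip N) hs hs0 hs1 (by omega) (hβ _) hy
      ?_ (fun t ht => ?_)
    · rwa [shift_shift, add_comm 1, ← hjl]
    · by_cases ht' : t + 1 < j
      · exact hyt t ht' (by omega)
      · obtain rfl : t = 2 ^ N * m - 1 := by omega
        rw [h.last]
        simp only [shift]
        rw [show 1 + (2 ^ N * m - 1) = j by omega, hcj]; rfl
  · have h6 : 2 ^ (N + 1) * m - 1 = 2 ^ N * m - 1 + 2 ^ N * m := by omega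
    refine h.no_branch_of_gt hs hs0 hs1 hsN hβ (hc.tail (2 ^ N * m)) (r := N + 1)
      (j := j - 2 ^ N * m) (by omega) (by omega) ?_ (fun i hi => ?_) ?_ ?_
    · simp only [shift, add_zero]
      rw [hcd _ hjl, ← h6, h.last]
    · simp only [shift]
      rw [hcd _ (by omega), h6, add_assoc]
    · rw [← hcj]; simp only [shift]; congr 1; omega
    · rw [← hdj]; congr 1; omega

/-- A sequence that satisfies the lexicographic conditions with respect to `β` cannot branch off
below a tail of `θ` beginning at a position `2ʳm`, if `β` branches off `θ` before. -/
theorem IsDoubling.no_branch (h : IsDoubling θ m)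
    (hs : ∀ i < s, β i = θ i) (hs0 : β s = 0) (hs1 : θ s = 1)
    (hβ : ∀ i, ¬ LexLT β (shift β i)) (hc : IsLexUnivoque β c) {r j : ℕ}
    (hj : 0 < j) (hc0 : c 0 = 1) (hcd : ∀ i < j, c i = θ (2 ^ r * m - 1 + i)) (hcj : c j = 0)
    (hdj : θ (2 ^ r * m - 1 + j) = 1) (hsj : s < 2 ^ r * m + j) : False := by
  classical
  have hm := h.pos
  have hex : ∃ N, s < 2 ^ (N + 1) * m := ⟨s, by
    calc s < 2 ^ s := Nat.lt_two_pow_self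
      _ ≤ 2 ^ (s + 1) := Nat.pow_le_pow_right (by norm_num) (by omega)
      _ ≤ _ := Nat.le_mul_of_pos_right _ hm⟩
  have hN := Nat.find_spec hex
  have hN' := fun n (hn : n < Nat.find hex) => Nat.find_min hex hn
  generalize Nat.find hex = N at hN hN'
  rcases lt_trichotomy N r with hr | rfl | hr
  · exact h.no_branch_of_gt hs hs0 hs1 hN hβ hc hr hj hc0 hcd hcj hdj
  · exact h.no_branch_of_eq hs hs0 hs1 hN hβ hc hj hc0 hcd hcj hdj
  -- By minimality of N, 2^N m ≤ s, so c still follows θ through index 2^N m - 1 and may be cut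
  -- there.
  · have h1 := hN' (N - 1) (by omega)
    rw [show N - 1 + 1 = N by omega, not_lt] at h1
    have h2 : 2 ^ r * m ≤ 2 ^ N * m :=
      Nat.mul_le_mul_right _ (Nat.pow_le_pow_right (by norm_num) hr.le)
    have h3 : 0 < 2 ^ r * m := by positivity
    refine h.no_branch_of_eq hs hs0 hs1 hN hβ (hc.tail (2 ^ N * m - 2 ^ r * m))
      (j := j - (2 ^ N * m - 2 ^ r * m)) (by omega) ?_ (fun i hi => ?_) ?_ ?_
    · simp only [shift, add_zero]
      rw [hcd _ (by omega), ← h.last N]; congr 1; omega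
    · simp only [shift]
      rw [hcd _ (by omega)]; congr 1; omega
    · rw [← hcj]; simp only [shift]; congr 1; omega
    · rw [← hdj]; congr 1; omega

end Branch

/-! ### Comparing unique expansions in two bases -/

theorem IsUnivoque.lt_seqValue {p : ℝ} (hp : 1 < p) {c : BinSeq} (hc : IsUnivoque p c) {k : ℕ}
    (hk : c k = 1) : 1 / (p * (p - 1)) < seqValue p (shift c k) := by
  have h0 : 0 < p := by linarith
  have h1 : 0 < p - 1 := by linarith
  have h2 := (hc k).2 hk
  rw [seqValue_reflectSeq hp] at h2
  rw [seqValue_succ hp, shift_shift, lt_div_iff₀ h0]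
  have h3 : (shift c k) 0 = 1 := hk
  rw [h3]
  have h4 : 1 / (p * (p - 1)) * p = 1 / (p - 1) := by field_simp
  rw [h4]
  simp at h2 ⊢
  linarith

/-- The block 01 in a unique expansion forces p above the golden ratio: the tail starting at this 1
exceeds 1/(p(p-1)) and is below 1. -/
theorem IsUnivoque.one_lt_mul {p : ℝ} (hp : 1 < p) {c : BinSeq} (hc : IsUnivoque p c) {k : ℕ}
    (hk : c k = 0) (hk' : c (k + 1) = 1) : 1 < p * (p - 1) := by
  have h1 : 0 < p - 1 := by linarith
  have h2 := (hc.lt_seqValue hp hk').trans ((hc k).1 hk)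
  rwa [div_lt_one (by positivity)] at h2

theorem exists_digit_one {p : ℝ} {c : BinSeq} (h : 0 < seqValue p c) : ∃ i, c i = 1 := by
  by_contra hc
  push Not at hc
  have : ∀ i, c i = 0 := fun i => (fin_two_cases (c i)).resolve_right (hc i)
  simp [seqValue, this] at h

theorem seqValue_shift_sub_le {p q : ℝ} (hp : 1 < p) (hpq : p ≤ q) (d : BinSeq) (n : ℕ) :
    seqValue p (shift d n) - seqValue q (shift d n) ≤ p ^ n * (seqValue p d - seqValue q d) := by
  have hq := hp.trans_le hpq
  have h0 : 0 < p := by linarith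
  rw [seqValue_split hp d n, seqValue_split hq d n]
  have h1 := prefixValue_anti hp hpq d n
  have h2 : seqValue q (shift d n) / q ^ n ≤ seqValue q (shift d n) / p ^ n := by
    have := seqValue_nonneg hq (shift d n)
    gcongr
  have h3 : 0 < p ^ n := by positivity
  calc _ = p ^ n * (seqValue p (shift d n) / p ^ n - seqValue q (shift d n) / p ^ n) := by
        field_simp
    _ ≤ _ := mul_le_mul_of_nonneg_left (by linarith) h3.le

/-- If `c` is a unique expansion in base `p < q` of the number with expansion `d` in base `q`,
then `c` branches off below `d`, and this happens quantitatively early. -/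
theorem exists_branch {p q : ℝ} (hp : 1 < p) (hpq : p < q) {c d : BinSeq} (hc : IsUnivoque p c)
    (hd : IsUnivoque q d) (hd0 : d 0 = 1) (hval : seqValue p c = seqValue q d) :
    ∃ j, (∀ i < j, c i = d i) ∧ c j = 0 ∧ d j = 1 ∧
      seqValue p (shift d (j + 1)) / p ^ (j + 1) < seqValue p d - seqValue q d := by
  have hq := hp.trans hpq
  have h0 : 0 < p := by linarith
  have h1 : 0 < q := by linarith
  rcases lexLT_trichotomy c d with rfl | ⟨k, hk, hk0, hk1⟩ | ⟨k, hk, hk0, hk1⟩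
  · have := seqValue_strictAnti hp hpq hd0
    linarith
  · refine ⟨k, hk, hk0, hk1, ?_⟩
    rw [← hval, seqValue_sub_of_first_diff hp hk hk0 hk1]
    have := (hc k).1 hk0
    gcongr
    linarith
  · exfalso
    have h2 := seqValue_sub_of_first_diff hq hk hk0 hk1
    have h3 := (hd k).1 hk0
    have h4 := seqValue_nonneg hq (shift c (k + 1))
    have h5 := seqValue_strictAnti hp hpq (d := c) (k := k) hk1
    have h6 : 0 < (1 + seqValue q (shift c (k + 1)) - seqValue q (shift d (k + 1))) / q ^ (k + 1) :=
      div_pos (by linarith) (by positivity)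
    linarith

/-- A leading 0 of c gives 1/(q(q-1)) < x < 1/p, hence p < q(q-1). The first 1 of c then ends a
block 01, so p exceeds the golden ratio, which is too large when q is below the tribonacci number
(about 1.839). -/
theorem head_eq_one_of_small_base {p q : ℝ} (hp : 1 < p) (hpq : p < q)
    (hq3 : q ^ 3 < q ^ 2 + q + 1) {c d : BinSeq} (hc : IsUnivoque p c)
    (hd : IsUnivoque q d) (hd0 : d 0 = 1) (hval : seqValue p c = seqValue q d) : c 0 = 1 := by
  have hq := hp.trans hpq
  have h0 : 0 < p := by linarith
  have h1 : 0 < q - 1 := by linarith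
  by_contra hc0
  replace hc0 := (fin_two_cases (c 0)).resolve_right hc0
  have h2 := hd.lt_seqValue hq hd0
  rw [shift_zero] at h2
  have h3 := (hc 0).1 hc0
  have h4 := seqValue_succ hp c
  rw [hc0] at h4
  have h5 : seqValue p c < 1 / p := by
    rw [h4]; simp only [Fin.val_zero, Nat.cast_zero, zero_add] at h3 ⊢; gcongr
  have h6 : 1 / (q * (q - 1)) < 1 / p := by linarith
  rw [one_div_lt_one_div (by positivity) h0] at h6
  classical
  have h7 : ∃ i, c i = 1 := exists_digit_one (p := p) (by
    rw [hval]; exact seqValue_pos hq hd0)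
  have h8 := Nat.find_spec h7
  have h9 := fun i (hi : i < Nat.find h7) => Nat.find_min h7 hi
  generalize Nat.find h7 = k at h8 h9
  have hk : k ≠ 0 := by
    rintro rfl; rw [hc0] at h8; exact absurd h8 (by decide)
  obtain ⟨l, rfl⟩ := Nat.exists_eq_succ_of_ne_zero hk
  have h10 := hc.one_lt_mul hp ((fin_two_cases (c l)).resolve_right (h9 l (by omega))) h8
  have h11 : q < 1.84 := by
    by_contra hcon
    push Not at hcon
    nlinarith [mul_nonneg (sub_nonneg.2 hcon) (sub_nonneg.2 hcon), sq_nonneg q,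
      mul_nonneg (mul_nonneg (sub_nonneg.2 hcon) (sub_nonneg.2 hcon)) h1.le]
  have h12 : p < 1.55 := by nlinarith
  nlinarith

theorem IsDoubling.exists_early_branch {p q : ℝ} (hp : 1 < p) (hpq : p < q)
    {θ β c : BinSeq} {m s : ℕ} (h : IsDoubling θ m) (hθ : seqValue q θ = 1)
    (hβ : seqValue p β = 1) (hs : ∀ i < s, β i = θ i) (hq3 : q ^ 3 < q ^ 2 + q + 1)
    (hc : IsUnivoque p c) {n : ℕ} (hn : 0 < n) (hn1 : θ (n - 1) = 1)
    (hval : seqValue p c = seqValue q (shift θ (n - 1))) :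
    c 0 = 1 ∧ ∃ j, 0 < j ∧ (∀ i < j, c i = θ (n - 1 + i)) ∧ c j = 0 ∧ θ (n - 1 + j) = 1 ∧
      s < n + j ∧ seqValue p (shift θ (n + j)) / p ^ (j + 1)
        < seqValue p (shift θ (n - 1)) - seqValue q (shift θ (n - 1)) := by
  have hq := hp.trans hpq
  have h0 : 0 < p := by linarith
  have hd := (h.isUnivoque hq hθ).tail (n - 1)
  have hc0 := head_eq_one_of_small_base hp hpq hq3 hc hd hn1 hval
  obtain ⟨j, hj, hj0, hj1, hj2⟩ := exists_branch hp hpq hc hd hn1 hval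
  have hjpos : 0 < j := by
    rcases Nat.eq_zero_or_pos j with rfl | h1
    · rw [hc0] at hj0; exact absurd hj0 (by decide)
    · exact h1
  rw [shift_shift, show n - 1 + (j + 1) = n + j by omega] at hj2
  refine ⟨hc0, j, hjpos, hj, hj0, hj1, ?_, hj2⟩
  -- If β agreed with θ through the branching digit, that prefix of θ would have value at most 1 in
  -- base p. The tail of θ after it would then account for the whole excess of θ over 1, against the
  -- bound from `exists_branch`.
  by_contra hcon
  push Not at hcon
  have h1 := seqValue_shift_sub_le hp hpq.le θ (n - 1)
  have h2 : prefixValue p θ (n + j) ≤ 1 := by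
    rw [← hβ, ← prefixValue_congr (fun i hi => hs i (by omega))]
    exact prefixValue_le hp _ _
  have h3 := hj2.trans_le h1
  have h4 := seqValue_split hp θ (n + j)
  rw [div_lt_iff₀ (by positivity)] at h3
  have h5 : p ^ (n - 1) * (seqValue p θ - seqValue q θ) * p ^ (j + 1)
      = p ^ (n + j) * (seqValue p θ - 1) := by
    rw [hθ, show n + j = (n - 1) + (j + 1) by omega, pow_add]; ring
  have h6 : seqValue p θ - 1 ≤ seqValue p (shift θ (n + j)) / p ^ (n + j) := by linarith
  rw [le_div_iff₀ (by positivity)] at h6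
  linarith

/-! ### Minimality at the positions 2^r m -/

theorem IsDoubling.mem_univoqueBases {q : ℝ} (hq : 1 < q) (hq2 : q ≤ 2) {θ : BinSeq} {m : ℕ}
    (h : IsDoubling θ m) (hθ : seqValue q θ = 1) (k : ℕ) :
    q ∈ univoqueBases (seqValue q (shift θ k)) :=
  mem_univoqueBases_iff.2 ⟨hq, hq2, _, (h.isUnivoque hq hθ).tail k, rfl⟩

theorem IsDoubling.isLeast_of_pow {q : ℝ} (hq : 1 < q) (hq2 : q ≤ 2)
    (hq3 : q ^ 3 < q ^ 2 + q + 1) {θ : BinSeq} {m : ℕ}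
    (h : IsDoubling θ m) (hθ : seqValue q θ = 1) (r : ℕ) :
    IsLeast (univoqueBases (seqValue q (shift θ (2 ^ r * m - 1)))) q := by
  have hm := h.pos
  refine ⟨h.mem_univoqueBases hq hq2 hθ _, fun p hp => ?_⟩
  obtain ⟨hp1, hp2, c, hc, hval⟩ := mem_univoqueBases_iff.1 hp
  by_contra hpq
  push Not at hpq
  obtain ⟨β, hβ, hβ'⟩ := exists_quasiGreedy hp1 hp2
  obtain ⟨s, hs, hs0, hs1⟩ := h.quasiGreedy_lexLT hp1 hpq hθ hβ
  obtain ⟨hc0, j, hj, hcd, hcj, hdj, hsj, -⟩ := h.exists_early_branch hp1 hpq hθ hβ hs hq3 hc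
    (n := 2 ^ r * m) (by positivity) (h.last r) hval
  exact h.no_branch hs hs0 hs1 (not_lexLT_shift_of_quasiGreedy hp1 hβ hβ')
    (hc.isLexUnivoque hp1 hβ fun i => (hβ' i).2) hj hc0 hcd hcj hdj hsj

/-! ### Minimality one block before 2^(2k+1) m -/

theorem IsDoubling.flip_last_block {θ : BinSeq} {m : ℕ} (h : IsDoubling θ m) (k : ℕ) {i : ℕ}
    (hi : i + 1 < m) : θ (2 ^ (2 * k + 1) * m - m + i) = 1 - θ i := by
  -- Each doubling reflects the last block apart from its final digit; the number 2k + 1 of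
  -- doublings is odd.
  have hstep : ∀ r, θ (2 ^ (r + 1) * m - m + i) = 1 - θ (2 ^ r * m - m + i) := by
    intro r
    have h1 : m ≤ 2 ^ r * m := Nat.le_mul_of_pos_left _ (by positivity)
    have h2 : 2 ^ (r + 1) * m = 2 ^ r * m + 2 ^ r * m := by ring
    rw [← h.flip r _ (by omega)]
    congr 1; omega
  induction k with
  | zero => rw [hstep]; simp
  | succ k ih => rw [show 2 * (k + 1) + 1 = 2 * k + 1 + 1 + 1 by ring, hstep, hstep, ih,
      one_sub_one_sub_fin_two]

theorem IsDoubling.before_last_block {θ : BinSeq} {m : ℕ} (h : IsDoubling θ m) (k : ℕ) :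
    θ (2 ^ (2 * k + 1) * m - m - 1) = 1 := by
  have hm := h.pos
  have hstep : ∀ r, 0 < r → θ (2 ^ (r + 1) * m - m - 1) = 1 - θ (2 ^ r * m - m - 1) := by
    intro r hr
    have h0 : 2 ≤ 2 ^ r := by
      calc 2 = 2 ^ 1 := rfl
        _ ≤ _ := Nat.pow_le_pow_right (by norm_num) hr
    have h1 : 2 * m ≤ 2 ^ r * m := Nat.mul_le_mul_right _ h0
    have h2 : 2 ^ (r + 1) * m = 2 ^ r * m + 2 ^ r * m := by ring
    rw [← h.flip r _ (by omega)]
    congr 1; omega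
  induction k with
  | zero =>
    have := h.last 0
    rw [← this]; congr 1; omega
  | succ k ih => rw [show 2 * (k + 1) + 1 = 2 * k + 1 + 1 + 1 by ring, hstep _ (by omega),
      hstep _ (by omega), ih]; rfl

/-- A change of base costs most when all digits are 1: monotonicity is applied to the reflection. -/
theorem seqValue_div_sub_le {p q : ℝ} (hp : 1 < p) (hpq : p ≤ q) (z : BinSeq) (k : ℕ) :
    seqValue p z / p ^ k - seqValue q z / q ^ k
      ≤ 1 / (p - 1) / p ^ k - 1 / (q - 1) / q ^ k := by
  have hq := hp.trans_le hpq
  have h0 : 0 < p := by linarith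
  have h1 := seqValue_anti hp hpq (reflectSeq z)
  have h2 := seqValue_nonneg hp (reflectSeq z)
  have h3 : seqValue q (reflectSeq z) / q ^ k ≤ seqValue p (reflectSeq z) / p ^ k := by gcongr
  rw [seqValue_reflectSeq hp, seqValue_reflectSeq hq, sub_div, sub_div] at h3
  linarith

/-- With a = 1/p and b = 1/q in [1/2, 1), the bounds become A ≥ 2(a - b) and X ≤ 6(a - b), and p³ ≥
4 suffices. -/
theorem base_change_estimate {p q A X : ℝ} (hp : 1.61 ≤ p) (hpq : p < q) (hq : q ≤ 2)
    (hA : (1 / p + 1 / p ^ 2) - (1 / q + 1 / q ^ 2) ≤ A)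
    (hX : X ≤ (1 / p - 1 / q) + (1 / (p - 1) / p ^ 3 - 1 / (q - 1) / q ^ 3)) :
    1.25 * X ≤ p ^ 3 * A := by
  have h0 : 0 < p := by linarith
  have h1 : 0 < q := by linarith
  have h2 : 0 < p - 1 := by linarith
  have h3 : 0 < q - 1 := by linarith
  have hid : ∀ t : ℝ, 0 < t → 0 < t - 1 →
      1 / (t - 1) / t ^ 3 = 1 / (t - 1) - 1 / t - (1 / t) ^ 2 - (1 / t) ^ 3 := by
    intro t ht ht'
    field_simp
    ring
  rw [hid p h0 h2, hid q h1 h3] at hX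
  have h4 : 1 / (p - 1) - 1 / (q - 1) ≤ 7 * (1 / p - 1 / q) := by
    have e1 : 1 / (p - 1) - 1 / (q - 1) = (q - p) / ((p - 1) * (q - 1)) := by
      field_simp; ring
    have e2 : 7 * (1 / p - 1 / q) = (q - p) * 7 / (p * q) := by
      field_simp
    rw [e1, e2, div_le_div_iff₀ (by positivity) (by positivity), mul_assoc]
    have e3 : p * q ≤ 7 * ((p - 1) * (q - 1)) := by
      -- The constant works for p ≥ 1.61, and 2.64² < 7.
      have e4 : p ≤ 2.64 * (p - 1) := by linarith
      have e5 : q ≤ 2.64 * (q - 1) := by linarith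
      have e6 : p * q ≤ (2.64 * (p - 1)) * (2.64 * (q - 1)) := by gcongr
      nlinarith [mul_pos h2 h3]
    exact mul_le_mul_of_nonneg_left e3 (by linarith)
  have ha : 1 / 2 ≤ 1 / p := by
    apply one_div_le_one_div_of_le h0; linarith
  have hb : 1 / 2 ≤ 1 / q := one_div_le_one_div_of_le h1 hq
  have hab : 1 / q < 1 / p := one_div_lt_one_div_of_lt h0 hpq
  rw [← one_div_pow, ← one_div_pow] at hA
  generalize 1 / p = a at *
  generalize 1 / q = b at *
  have h5 : a - b ≤ a ^ 2 - b ^ 2 := by nlinarith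
  have h6 : 0 ≤ a ^ 3 - b ^ 3 := by
    have : b ^ 3 ≤ a ^ 3 := by gcongr
    linarith
  have hA2 : 2 * (a - b) ≤ A := by linarith
  have hX2 : X ≤ 6 * (a - b) := by linarith
  have h7 : 4 ≤ p ^ 3 := by
    calc (4 : ℝ) ≤ 1.61 ^ 3 := by norm_num
      _ ≤ p ^ 3 := by gcongr
  have h8 : 4 * A ≤ p ^ 3 * A := mul_le_mul_of_nonneg_right h7 (by linarith)
  linarith

theorem IsDoubling.isLeast_of_last_block {q : ℝ} (hq : 1 < q) (hq2 : q ≤ 2)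
    (hq3 : q ^ 3 < q ^ 2 + q + 1) {θ : BinSeq} {m : ℕ} (h : IsDoubling θ m) (hm : 4 ≤ m)
    (h1 : θ 1 = 1) (h2 : θ 2 = 0)
    (hθ : seqValue q θ = 1) {k : ℕ} (hk : 0 < k) :
    IsLeast (univoqueBases (seqValue q (shift θ (2 ^ (2 * k + 1) * m - m - 1)))) q := by
  refine ⟨h.mem_univoqueBases hq hq2 hθ _, fun p hp => ?_⟩
  obtain ⟨hp1, hp2, c, hc, hval⟩ := mem_univoqueBases_iff.1 hp
  by_contra hpq
  push Not at hpq
  have hp0 : 0 < p := by linarith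
  obtain ⟨β, hβ, hβ'⟩ := exists_quasiGreedy hp1 hp2
  obtain ⟨s, hs, hs0, hs1⟩ := h.quasiGreedy_lexLT hp1 hpq hθ hβ
  have hbase : 4 * m ≤ 2 ^ (2 * k + 1) * m := by
    refine Nat.mul_le_mul_right _ ?_
    calc 4 = 2 ^ 2 := rfl
      _ ≤ _ := Nat.pow_le_pow_right (by norm_num) (by omega)
  have hflip := fun i (hi : i + 1 < m) => h.flip_last_block k hi
  have hblock := h.last (2 * k + 1)
  have hstart := h.before_last_block k
  have hnb := fun c' hc' j => @IsDoubling.no_branch θ β c' m s h hs hs0 hs1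
    (not_lexLT_shift_of_quasiGreedy hp1 hβ hβ') hc' (2 * k + 1) j
  have hflipM := h.flip (2 * k + 1)
  generalize hM : 2 ^ (2 * k + 1) * m = M at *
  obtain ⟨hc0, j, hj, hcd, hcj, hdj, hsj, hX⟩ := h.exists_early_branch hp1 hpq hθ hβ hs hq3 hc
    (n := M - m) (by omega) hstart hval
  have hlex := hc.isLexUnivoque hp1 hβ fun i => (hβ' i).2
  have hy := (hlex 0).2 hc0
  rw [zero_add] at hy
  have hyt : ∀ t, t + 1 < j → t + 1 < m → shift c 1 t = 1 - θ t := by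
    intro t ht ht'
    rw [← hflip t ht']
    simp only [shift]
    rw [hcd _ (by omega)]; congr 1; omega
  rcases lt_trichotomy j m with hjm | rfl | hjm
  · refine not_below_reflection (k := j - 1) ⟨s, hs, hs0, hs1⟩ hy
      (fun t ht => hyt t (by omega) (by omega)) ?_ ?_
    · rw [← hcj]; simp only [shift]; congr 1; omega
    · have h4 := hflip (j - 1) (by omega)
      rw [show M - m + (j - 1) = M - m - 1 + j by omega, hdj] at h4
      rw [← one_sub_one_sub_fin_two (θ _), ← h4]; rfl
  · have hpre : ∀ t < j, shift c 1 t = 1 - θ t := by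
      intro t ht
      by_cases ht' : t + 1 < j
      · exact hyt t ht' ht'
      · obtain rfl : t = j - 1 := by omega
        have h3 := h.last 0
        simp only [pow_zero, one_mul] at h3
        rw [h3]
        simp only [shift]
        rw [show 1 + (j - 1) = j by omega, hcj]; rfl
    -- From here on j stands for the common value of j and m.
    by_cases hs2 : s < 2 * j
    · have h3 := h.flip 0
      simp only [pow_zero, one_mul] at h3
      refine not_starts_with_reflection hj h3 hs hs0 hs1 hs2
        (not_lexLT_shift_of_quasiGreedy hp1 hβ hβ' _) hy ?_ hpre
      rw [shift_shift, add_comm 1]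
      exact (hlex j).1 hcj
    -- Now s ≥ 2m. Since θ starts with 110, c contains 01, so p exceeds the golden ratio and hence
    -- 1.61.
    · have hc1 : c 2 = 0 := by
        have := hpre 1 (by omega)
        rw [h1] at this; exact this
      have hc2 : c 3 = 1 := by
        have := hpre 2 (by omega)
        rw [h2] at this; exact this
      have hgold := hc.one_lt_mul hp1 hc1 hc2
      have hp161 : 1.61 ≤ p := by
        by_contra hcon
        push Not at hcon
        nlinarith
      rw [show M - j + j = M by omega] at hX
      have hA : (1 / p + 1 / p ^ 2) - (1 / q + 1 / q ^ 2) ≤ seqValue p θ - 1 := by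
        have e1 := seqValue_split hp1 θ 2
        have e2 := seqValue_split hq θ 2
        have e3 : seqValue q (shift θ 2) / q ^ 2 ≤ seqValue p (shift θ 2) / p ^ 2 := by
          have := seqValue_anti hp1 hpq.le (shift θ 2)
          have := seqValue_nonneg hp1 (shift θ 2)
          gcongr
        simp [prefixValue, Finset.sum_range_succ, h1, h.head] at e1 e2
        rw [hθ] at e2
        simp only [one_div]
        linarith
      have hXle : seqValue p (shift θ (M - j - 1)) - seqValue q (shift θ (M - j - 1))
          ≤ (1 / p - 1 / q) + (1 / (p - 1) / p ^ 3 - 1 / (q - 1) / q ^ 3) := by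
        have e0 : shift θ (M - j - 1) 0 = 1 := hstart
        have e1 : shift θ (M - j - 1) 1 = 0 := by
          have := hflip 0 (by omega)
          rw [h.head] at this
          rw [show (0 : Fin 2) = 1 - 1 from rfl, ← this]
          simp only [shift]; congr 1; omega
        have e2 : shift θ (M - j - 1) 2 = 0 := by
          have := hflip 1 (by omega)
          rw [h1] at this
          rw [show (0 : Fin 2) = 1 - 1 from rfl, ← this]
          simp only [shift]; congr 1; omega
        have e3 := seqValue_split hp1 (shift θ (M - j - 1)) 3
        have e4 := seqValue_split hq (shift θ (M - j - 1)) 3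
        have e5 := seqValue_div_sub_le hp1 hpq.le (shift (shift θ (M - j - 1)) 3) 3
        simp [prefixValue, Finset.sum_range_succ, e0, e1, e2] at e3 e4
        simp only [one_div] at e5 ⊢
        linarith
      have hest := base_change_estimate hp161 hpq hq2 hA hXle
      have hAS : seqValue p θ - 1 ≤ seqValue p (shift θ (2 * j)) / p ^ (2 * j) := by
        have e1 := seqValue_split hp1 θ (2 * j)
        have e2 : prefixValue p θ (2 * j) ≤ 1 := by
          rw [← hβ, ← prefixValue_congr (fun i hi => hs i (by omega))]
          exact prefixValue_le hp1 _ _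
        linarith
      -- The tails of θ at 2m and at M both begin with the first 2m - 1 digits of the reflection of
      -- θ.
      have hSR : seqValue p (shift θ (2 * j))
          ≤ seqValue p (shift θ M) + 1 / (p - 1) / p ^ (2 * j - 1) := by
        rw [seqValue_split hp1 (shift θ (2 * j)) (2 * j - 1),
          seqValue_split hp1 (shift θ M) (2 * j - 1)]
        have e1 : prefixValue p (shift θ (2 * j)) (2 * j - 1)
            = prefixValue p (shift θ M) (2 * j - 1) := by
          refine prefixValue_congr fun i hi => ?_
          have e2 := h.flip 1 i (by omega)
          simp only [shift]
          rw [hflipM i (by omega), ← e2, pow_one]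
        have e2 := seqValue_nonneg hp1 (shift (shift θ M) (2 * j - 1))
        have e3 : seqValue p (shift (shift θ (2 * j)) (2 * j - 1)) / p ^ (2 * j - 1)
            ≤ 1 / (p - 1) / p ^ (2 * j - 1) := by
          have := seqValue_le hp1 (shift (shift θ (2 * j)) (2 * j - 1))
          gcongr
        have e4 : 0 ≤ seqValue p (shift (shift θ M) (2 * j - 1)) / p ^ (2 * j - 1) := by
          positivity
        linarith
      have hR : 1 / p ^ 3 ≤ seqValue p (shift θ M) := by
        refine inv_pow_le_seqValue hp1 (k := 2) ?_
        simp only [shift]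
        rw [hflipM 2 (by omega), h2]; rfl
      have hsmall : 1 / (p - 1) / p ^ (2 * j - 1) ≤ 0.25 * (1 / p ^ 3) := by
        have e1 : p ^ 7 ≤ p ^ (2 * j - 1) := pow_le_pow_right₀ hp1.le (by omega)
        have e2 : 0 < p - 1 := by linarith
        calc _ ≤ 1 / (p - 1) / p ^ 7 := by gcongr
          _ ≤ _ := by
            have e3 : (4 : ℝ) ≤ p ^ 4 * (p - 1) := by
              calc (4 : ℝ) ≤ 1.61 ^ 4 * (1.61 - 1) := by norm_num
                _ ≤ _ := by gcongr
            rw [div_div, mul_one_div, div_le_div_iff₀ (by positivity) (by positivity)]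
            nlinarith [pow_pos hp0 3]
      rw [div_lt_iff₀ (by positivity)] at hX
      rw [le_div_iff₀ (by positivity)] at hAS
      generalize seqValue p (shift θ (M - j - 1)) - seqValue q (shift θ (M - j - 1)) = X at *
      have hApos : 0 < seqValue p θ - 1 := by
        have := seqValue_strictAnti hp1 hpq h.head
        linarith
      generalize seqValue p θ - 1 = A at *
      -- Let S and R be the values in base p of the tails at 2m and M. Then A p^{2m} ≤ S ≤ 1.25 R
      -- and R < X p^{m+1}, so A p^{m-1} < 1.25 X; as m ≥ 4, this contradicts 1.25 X ≤ p³ A.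
      have e1 : A * p ^ (2 * j) < 1.25 * (X * p ^ (j + 1)) := by linarith
      have e2 : A * p ^ (2 * j) = (A * p ^ (j - 1)) * p ^ (j + 1) := by
        rw [mul_assoc, ← pow_add]; congr 2; omega
      rw [e2, ← mul_assoc] at e1
      have e3 := lt_of_mul_lt_mul_right e1 (by positivity)
      have e4 : p ^ 3 ≤ p ^ (j - 1) := pow_le_pow_right₀ hp1.le (by omega)
      nlinarith
  -- For j > m the sequence c follows θ through index M - 1; cutting m digits reduces to position
  -- 2^{2k+1} m.
  · refine hnb (shift c m) (hlex.tail m) (j - m) (by omega) ?_ (fun i hi => ?_) ?_ ?_ (by omega)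
    · simp only [shift, add_zero]
      rw [hcd _ hjm, ← hblock]; congr 1; omega
    · simp only [shift]
      rw [hcd _ (by omega)]; congr 1; omega
    · rw [← hcj]; simp only [shift]; congr 1; omega
    · rw [← hdj]; congr 1; omega

/-! ### The Thue–Morse sequence and the first digits of θ -/

theorem thueMorse_rec {n : ℕ} (hn : 0 < n) : thueMorse n = (n + thueMorse (n / 2)) % 2 := by
  unfold thueMorse
  rw [Nat.digits_def' (by norm_num) hn, List.sum_cons]
  omega

theorem thueMorse_pow_add {N j : ℕ} (hj : j < 2 ^ N) :
    thueMorse (2 ^ N + j) = 1 - thueMorse j := by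
  induction N generalizing j with
  | zero =>
    obtain rfl : j = 0 := by simpa using hj
    simp [thueMorse]
  | succ N ih =>
    have h1 : 0 < 2 ^ N := by positivity
    have h2 : 2 ^ (N + 1) = 2 * 2 ^ N := by ring
    have h3 := ih (j := j / 2) (by omega)
    rw [thueMorse_rec (by omega), show (2 ^ (N + 1) + j) / 2 = 2 ^ N + j / 2 by omega, h3]
    have h4 : thueMorse (j / 2) < 2 := Nat.mod_lt _ (by norm_num)
    rcases Nat.eq_zero_or_pos j with rfl | hj0
    · simp [thueMorse]; omega
    · rw [thueMorse_rec hj0]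
      omega

/-- The Thue-Morse sequence from its second term on, as a digit sequence. -/
def thueMorseSeq : BinSeq := fun i => if thueMorse (i + 1) = 1 then 1 else 0

theorem thueMorseSeq_val (i : ℕ) : (thueMorseSeq i : ℕ) = thueMorse (i + 1) := by
  have h4 : thueMorse (i + 1) < 2 := Nat.mod_lt _ (by norm_num)
  unfold thueMorseSeq
  split_ifs with h
  · simp [h]
  · simp; omega

theorem IsKomornikLoreti.seqValue_eq {q : ℝ} (h : IsKomornikLoreti q) :
    seqValue q thueMorseSeq = 1 := by
  have h1 := h.2.tsum_eq
  rw [← h1]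
  unfold seqValue
  simp only [thueMorseSeq_val]

theorem IsDoubling.eq_thueMorseSeq {θ : BinSeq} (h : IsDoubling θ 1) : θ = thueMorseSeq := by
  funext i
  induction i using Nat.strong_induction_on with
  | _ i ih =>
    have h1 := Nat.pow_log_le_self 2 (x := i + 1) (by omega)
    have h2 := Nat.lt_pow_succ_log_self (b := 2) (by norm_num) (i + 1)
    generalize Nat.log 2 (i + 1) = N at h1 h2
    have h3 : 2 ^ (N + 1) = 2 * 2 ^ N := by ring
    have hp : 0 < 2 ^ N := by positivity
    obtain ⟨j, hj⟩ := Nat.exists_eq_add_of_le h1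
    have h4 := thueMorse_pow_add (N := N) (j := j) (by omega)
    rcases Nat.eq_zero_or_pos j with rfl | hj0
    · have h5 := h.last N
      rw [mul_one, show 2 ^ N - 1 = i by omega] at h5
      rw [h5]
      unfold thueMorseSeq
      rw [hj, h4]
      simp [thueMorse]
    · have h5 := h.flip N (j - 1) (by omega)
      rw [mul_one, show 2 ^ N + (j - 1) = i by omega, ih (j - 1) (by omega)] at h5
      rw [h5]
      unfold thueMorseSeq
      rw [hj, h4, show j - 1 + 1 = j by omega]
      have h6 : thueMorse j < 2 := Nat.mod_lt _ (by norm_num)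
      interval_cases thueMorse j <;> simp

theorem IsDoubling.of_two {θ : BinSeq} (h : IsDoubling θ 2) : IsDoubling θ 1 := by
  have h1 : ∀ N, 2 ^ (N + 1) * 1 = 2 ^ N * 2 := fun N => by ring
  refine ⟨one_pos, fun N i hi => ?_, fun N => ?_, h.shift_lt, h.lt_shift⟩
  · cases N with
    | zero => simp at hi
    | succ N => rw [h1] at hi ⊢; exact h.flip N i hi
  · cases N with
    | zero => exact h.head
    | succ N => rw [h1]; exact h.last N

theorem IsAlpha.quasiGreedy {q : ℝ} {d : BinSeq} (h : IsAlpha q d) (hq : 1 < q) :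
    q ≤ 2 ∧ IsQuasiGreedy q 1 d := by
  rcases h with ⟨rfl, -⟩ | ⟨-, h2, h3⟩
  · exact absurd hq (lt_irrefl _)
  · exact ⟨h2, h3⟩

theorem IsQuasiGreedy.unique {q x : ℝ} {d e : BinSeq} (hd : IsQuasiGreedy q x d)
    (he : IsQuasiGreedy q x e) : d = e :=
  toLex.injective (le_antisymm (he.2 d hd.1.1 hd.1.2) (hd.2 e he.1.1 he.1.2))

/-- Since q_KL is at least the golden ratio, 1/q + 1/q² < 1, which forces θ to begin with 11; q < Q₃
excludes 111. For m = 3 the third digit would be 1, and for m = 1 or 2 θ would be the Thue–Morse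
sequence, so q = q_KL. -/
theorem IsDoubling.digits_of_base {qKL Q₃ q : ℝ} (hKL : IsKomornikLoreti qKL)
    (hQ : IsTribonacci Q₃) (hq1 : qKL < q) (hq2 : q < Q₃) {θ : BinSeq} {m : ℕ}
    (h : IsDoubling θ m) (hθ : seqValue q θ = 1) :
    q ^ 3 < q ^ 2 + q + 1 ∧ 4 ≤ m ∧ θ 1 = 1 ∧ θ 2 = 0 := by
  have hKL1 : 1 < qKL := hKL.1.1
  have hKL0 : 0 < qKL := by linarith
  have hq : 1 < q := hKL1.trans hq1
  have hq0 : 0 < q := by linarith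
  have hKLval := hKL.seqValue_eq
  have ht0 : thueMorseSeq 0 = 1 := by simp [thueMorseSeq, thueMorse]
  have ht1 : thueMorseSeq 1 = 1 := by simp [thueMorseSeq, thueMorse]
  have hgold : 1 / q + 1 / q ^ 2 < 1 := by
    have h1 := prefixValue_le hKL1 thueMorseSeq 2
    simp [hKLval, prefixValue, Finset.sum_range_succ, ht0, ht1] at h1
    have h2 : 1 / q < 1 / qKL := by gcongr
    have h3 : 1 / q ^ 2 < 1 / qKL ^ 2 := by gcongr
    simp only [one_div] at *
    linarith
  have htri : 1 < 1 / q + 1 / q ^ 2 + 1 / q ^ 3 := by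
    have h1 : 1 / Q₃ < 1 / q := by gcongr
    have h2 : 1 / Q₃ ^ 2 < 1 / q ^ 2 := by gcongr
    have h3 : 1 / Q₃ ^ 3 < 1 / q ^ 3 := by gcongr
    linarith [hQ.2]
  have h1 : θ 1 = 1 := by
    refine (fin_two_cases _).resolve_left fun h0 => ?_
    have h2 := h.seqValue_shift_lt_one hq hθ (i := 2) (by norm_num)
    have h3 := seqValue_split hq θ 2
    simp [prefixValue, Finset.sum_range_succ, h.head, h0, hθ] at h3
    have h4 : seqValue q (shift θ 2) / q ^ 2 < 1 / q ^ 2 := by gcongr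
    simp only [one_div] at *
    linarith
  have h2 : θ 2 = 0 := by
    refine (fin_two_cases _).resolve_right fun h0 => ?_
    have h3 := prefixValue_le hq θ 3
    simp [prefixValue, Finset.sum_range_succ, h.head, h0, h1, hθ] at h3
    simp only [one_div] at *
    linarith
  refine ⟨?_, ?_, h1, h2⟩
  · have : 1 / q + 1 / q ^ 2 + 1 / q ^ 3 = (q ^ 2 + q + 1) / q ^ 3 := by field_simp
    rwa [this, one_lt_div (by positivity)] at htri
  · by_contra hm
    have hpos := h.pos
    have hne1 : ¬ IsDoubling θ 1 := fun h' => by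
      have h3 := seqValue_strictAnti hKL1 hq1 ht0
      rw [← h'.eq_thueMorseSeq, hθ, h'.eq_thueMorseSeq, hKLval] at h3
      exact lt_irrefl _ h3
    have hm' : m = 1 ∨ m = 2 ∨ m = 3 := by omega
    rcases hm' with rfl | rfl | rfl
    · exact hne1 h
    · exact hne1 h.of_two
    · have h3 := h.last 0
      simp [h2] at h3

/-! ### Infinitely many infinite level sets -/

/-- The word `1(10)ᵏ`. -/
def oneAlternatingWord (k : ℕ) : List (Fin 2) :=
  List.ofFn fun i : Fin (2 * k + 1) => if (i : ℕ) = 0 ∨ (i : ℕ) % 2 = 1 then 1 else 0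

theorem oneAlternatingWord_length (k : ℕ) : (oneAlternatingWord k).length = 2 * k + 1 := by
  simp [oneAlternatingWord]

theorem oneAlternatingWord_getElem {k i : ℕ} (hi : i < (oneAlternatingWord k).length) :
    (oneAlternatingWord k)[i] = if i = 0 ∨ i % 2 = 1 then 1 else 0 := by
  simp only [oneAlternatingWord, List.getElem_ofFn]

theorem oneAlternatingWord_isAdmissible (k : ℕ) : IsAdmissible (oneAlternatingWord k) := by
  have hlen := oneAlternatingWord_length k
  refine ⟨List.ne_nil_of_length_pos (by omega), fun i hi hil => ?_⟩
  have hi0 : i ≠ 0 := by omega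
  refine ⟨?_, ?_⟩
  · rcases Nat.mod_two_eq_zero_or_one i with h | h
    · have h' : (i + 1) % 2 = 1 := by omega
      by_cases hik : i = 2 * k
      · apply le_of_eq
        apply List.ext_getElem
        · simp [reflectWord, hlen]
        · intro t ht ht'
          simp [hlen] at ht'
          obtain rfl : t = 0 := by omega
          simp only [reflectWord, List.getElem_map, List.getElem_take, List.getElem_drop,
            oneAlternatingWord_getElem]
          simp [h, hi0]
      · apply le_of_lt
        rw [List.lt_iff_exists]
        refine Or.inr ⟨1, by simp [reflectWord, hlen]; omega, by simp [hlen]; omega,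
          fun t ht => ?_, ?_⟩
        · obtain rfl : t = 0 := by omega
          simp only [reflectWord, List.getElem_map, List.getElem_take, List.getElem_drop,
            oneAlternatingWord_getElem]
          simp [h, hi0]
        · simp only [reflectWord, List.getElem_map, List.getElem_take, List.getElem_drop,
            oneAlternatingWord_getElem]
          simp [h']
    · have h' : (i + 1) % 2 = 0 := by omega
      apply le_of_lt
      rw [List.lt_iff_exists]
      refine Or.inr ⟨0, by simp [reflectWord, hlen]; omega, by simp [hlen]; omega,
        fun t ht => absurd ht (by omega), ?_⟩
      simp only [reflectWord, List.getElem_map, List.getElem_take, List.getElem_drop,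
        oneAlternatingWord_getElem]
      simp [h]
  · rw [List.lt_iff_exists]
    rcases Nat.mod_two_eq_zero_or_one i with h | h
    · refine Or.inr ⟨0, by simp [hlen]; omega, by simp [hlen]; omega,
        fun t ht => absurd ht (by omega), ?_⟩
      simp only [List.getElem_take, List.getElem_drop, oneAlternatingWord_getElem]
      simp [h, hi0]
    · have h' : (i + 1) % 2 = 0 := by omega
      refine Or.inr ⟨1, by simp [hlen]; omega, by simp [hlen]; omega, fun t ht => ?_, ?_⟩
      · obtain rfl : t = 0 := by omega
        simp only [List.getElem_take, List.getElem_drop, oneAlternatingWord_getElem]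
        simp [h]
      · simp only [List.getElem_take, List.getElem_drop, oneAlternatingWord_getElem]
        simp [h']

theorem thetaSeq_oneAlternatingWord {k i : ℕ} (hi : i < 2 * k) :
    thetaSeq (oneAlternatingWord k) i = if i = 0 ∨ i % 2 = 1 then 1 else 0 := by
  have hlen := oneAlternatingWord_length k
  rw [thetaSeq_prefix (oneAlternatingWord_isAdmissible k).1 (by omega),
    List.getD_eq_getElem _ _ (by omega), oneAlternatingWord_getElem]

/-- Intermediate values on [1.6, 2]: 1.6 is below the golden ratio, so the digits 11 alone already
give at least 1 there. -/
theorem exists_base_of_digits {θ : BinSeq} (h0 : θ 0 = 1) (h1 : θ 1 = 1) :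
    ∃ q : ℝ, 1 < q ∧ q ≤ 2 ∧ seqValue q θ = 1 := by
  have hcont : ContinuousOn (fun q : ℝ => seqValue q θ) (Icc 1.6 2) := by
    refine continuousOn_tsum (u := fun i => 1 / (1.6 : ℝ) ^ (i + 1)) (fun i => ?_)
      (hasSum_ones (by norm_num)).summable (fun i x hx => ?_)
    · refine continuousOn_const.div (continuousOn_id.pow _) fun x hx => ?_
      have : (0 : ℝ) < x := lt_of_lt_of_le (by norm_num) hx.1
      exact (pow_pos this _).ne'
    · have hx0 : (0 : ℝ) < x := lt_of_lt_of_le (by norm_num) hx.1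
      have h2 := digit_nonneg (θ i)
      have h3 := digit_le_one (θ i)
      have h4 := hx.1
      rw [Real.norm_of_nonneg (by positivity)]
      gcongr
  have h2 : seqValue 2 θ ≤ 1 := (seqValue_le (by norm_num) θ).trans (by norm_num)
  have h3 : 1 ≤ seqValue 1.6 θ := by
    refine le_trans ?_ (prefixValue_le (by norm_num) θ 2)
    simp [prefixValue, Finset.sum_range_succ, h0, h1]
    norm_num
  obtain ⟨q, hq, hq1⟩ := intermediate_value_Icc' (by norm_num) hcont ⟨h2, h3⟩
  exact ⟨q, lt_of_lt_of_le (by norm_num) hq.1, hq.2, hq1⟩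

theorem IsDoubling.infinite_levelSet {q : ℝ} (hq : 1 < q) (hq2 : q ≤ 2)
    (hq3 : q ^ 3 < q ^ 2 + q + 1) {θ : BinSeq} {m : ℕ}
    (h : IsDoubling θ m) (hθ : seqValue q θ = 1) : (levelSet q).Infinite := by
  have hm := h.pos
  refine infinite_of_injective_forall_mem
    (f := fun r : ℕ => seqValue q (shift θ (2 ^ r * m - 1))) ?_ fun r => ?_
  · refine .of_lt_imp_ne fun r t hrt heq => ?_
    have h1 := ((h.isUnivoque hq hθ).tail _).eq_of_seqValue_eq hq heq
    -- For r < t, the tails at 2^r m and 2^t m differ at this digit: the first has the final 1 of a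
    -- block, the second the reflection of such a 1.
    have h2 := congrFun h1 (2 ^ r * m)
    have hr : 0 < 2 ^ r * m := by positivity
    have h3 : 2 ^ r * m < 2 ^ t * m :=
      Nat.mul_lt_mul_of_pos_right (Nat.pow_lt_pow_right (by norm_num) hrt) hm
    have h4 := h.flip t (2 ^ r * m - 1) (by omega)
    have h5 := h.last (r + 1)
    have h6 : 2 ^ (r + 1) * m = 2 ^ r * m + 2 ^ r * m := by ring
    rw [h.last] at h4
    simp only [shift] at h2
    rw [show 2 ^ r * m - 1 + 2 ^ r * m = 2 ^ (r + 1) * m - 1 by omega, h5,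
      show 2 ^ t * m - 1 + 2 ^ r * m = 2 ^ t * m + (2 ^ r * m - 1) by omega, h4] at h2
    exact absurd h2 (by decide)
  · exact ⟨seqValue_pos hq (k := 0) (h.last r), (h.isLeast_of_pow hq hq2 hq3 hθ r).csInf_eq⟩

theorem infinite_setOf_infinite_levelSet :
    {q : ℝ | 1 < q ∧ (levelSet q).Infinite}.Infinite := by
  -- The exponent k + 2 avoids the word 110, whose raised last digit would make θ begin with 111.
  have hd : ∀ k, IsDoubling (thetaSeq (oneAlternatingWord (k + 2))) (2 * (k + 2) + 1) := fun k => by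
    have := (oneAlternatingWord_isAdmissible (k + 2)).isDoubling
    rwa [oneAlternatingWord_length] at this
  have h1 : ∀ k, thetaSeq (oneAlternatingWord (k + 2)) 1 = 1 := fun k =>
    thetaSeq_oneAlternatingWord (by omega)
  have h2 : ∀ k, thetaSeq (oneAlternatingWord (k + 2)) 2 = 0 := fun k =>
    thetaSeq_oneAlternatingWord (by omega)
  choose q hq hq2 hθ using fun k => exists_base_of_digits (hd k).head (h1 k)
  refine infinite_of_injective_forall_mem (f := q) ?_ fun k => ⟨hq k, ?_⟩
  · refine .of_lt_imp_ne fun k l hkl heq => ?_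
    have h3 := ((hd l).isUnivoque (hq l) (hθ l)).eq_of_seqValue_eq (hq l)
      (e := thetaSeq (oneAlternatingWord (k + 2))) (by rw [hθ l, ← heq, hθ k])
    -- At this digit the shorter word has its raised final 1, the longer one a 0.
    have h4 := congrFun h3 (2 * (k + 2))
    have h5 := (hd k).last 0
    rw [pow_zero, one_mul, Nat.add_sub_cancel] at h5
    rw [h5, thetaSeq_oneAlternatingWord (by omega), if_neg (by omega)] at h4
    exact absurd h4 (by decide)
  · have hq0 : 0 < q k := by linarith [hq k]
    refine (hd k).infinite_levelSet (hq k) (hq2 k) ?_ (hθ k)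
    -- With t < 1 the value of the tail after 110, q³ = q² + q + t.
    have h3 := (hd k).seqValue_shift_lt_one (hq k) (hθ k) (i := 3) (by norm_num)
    have h4 := seqValue_split (hq k) (thetaSeq (oneAlternatingWord (k + 2))) 3
    simp [prefixValue, Finset.sum_range_succ, (hd k).head, h1 k, h2 k, hθ k] at h4
    field_simp at h4
    nlinarith

theorem theorem5 :
    (∀ (qKL Q₃ : ℝ), IsKomornikLoreti qKL → IsTribonacci Q₃ →
      ∀ (a : List (Fin 2)) (q : ℝ), IsDeVriesKomornik a q → qKL < q → q < Q₃ →
      ∀ α : BinSeq, IsAlpha q α →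
      ∀ n k : ℕ, 1 ≤ k →
        (n = a.length * 2 ^ (k - 1) ∨ n = a.length * (2 ^ (2 * k - 1) - 1)) →
        IsLeast (univoqueBases (seqValue q (fun i => α (n - 1 + i)))) q) ∧
    {q : ℝ | 1 < q ∧ (levelSet q).Infinite}.Infinite := by
  refine ⟨?_, infinite_setOf_infinite_levelSet⟩
  rintro qKL Q₃ hKL hQ a q ⟨ha, -, -, -, hαθ⟩ hq1 hq2 α hα n k hk hn
  have hq : 1 < q := hKL.1.1.trans hq1
  obtain ⟨hq2', hθ⟩ := hαθ.quasiGreedy hq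
  obtain rfl : α = thetaSeq a := (hα.quasiGreedy hq).2.unique hθ
  have hval : seqValue q (thetaSeq a) = 1 := (isExpansion_iff hq _).1 hθ.1.1
  have h := ha.isDoubling
  obtain ⟨hq3, hm, h1, h2⟩ := h.digits_of_base hKL hQ hq1 hq2 hval
  change IsLeast (univoqueBases (seqValue q (shift (thetaSeq a) (n - 1)))) q
  rcases hn with rfl | rfl
  · rw [mul_comm]
    exact h.isLeast_of_pow hq hq2' hq3 hval (k - 1)
  · obtain ⟨l, rfl⟩ := Nat.exists_eq_add_of_le hk
    rw [show 2 * (1 + l) - 1 = 2 * l + 1 by omega, mul_comm, Nat.sub_mul, one_mul]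
    rcases Nat.eq_zero_or_pos l with rfl | hl
    -- The first member of the second family is n = m, which is the position 2^0 m.
    · have h3 := h.isLeast_of_pow hq hq2' hq3 hval 0
      rw [pow_zero, one_mul] at h3
      rwa [show 2 ^ (2 * 0 + 1) * a.length - a.length - 1 = a.length - 1 by omega]
    · exact h.isLeast_of_last_block hq hq2' hq3 hm h1 h2 hval hl
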